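/- Let $\nu_1$ be the probability measure on $\mathbb R$ with density $\frac12 e^{-|x|}$, and for $0<a<1$, $t>0$ let $c(a,t)=\nu_1((-\infty,b+t])$, where $b$ is given by $a=\nu_1((-\infty,b])$. A penalty on a probability space $(\Omega,\mu)$ is a measurable function $h:\Omega\times\Omega\to[0,\infty)$ with $h(x,x)=0$ for all $x$. For $B\subset\Omega$ put $h(x,B)=\inf\{h(x,y): y\in B\}$; for $A\subset\Omega^N$ and $x\in\Omega^N$ put $f_h(A,x)=\inf\{\sum_{i\le N}h(x_i,y_i): y\in A\}$; let $P=\mu^N$. All subsets $A,B$ are measurable, $1/0=\infty$, and integrals of functions that might not be measurable are upper integrals. We say that $(\mu,h)$ satisfies $(\ast)$ if, for each $B\subset\Omega$ with $0<\mu(B)<1$, $$0<t\le1\ \Rightarrow\ \mu(\{h(\cdot,B)\le t^2\})\ge c(\mu(B),t),\qquad t\ge1\ \Rightarrow\ \mu(\{h(\cdot,B)\le t\})\ge c(\mu(B),t).$$ (1) There is a universal constant $K>0$ such that, whenever a penalty $h$ satisfies $(\ast)$, then for each $N$ and each $A\subset\Omega^N$ $$\int_{\Omega^N}e^{f_h(A,x)/K}\,dP(x)\le\frac1{P(A)}.$$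 Here either $\Omega$ is an arbitrary probability space on which the functions $f_h(A,\cdot)$ (for all $N$ and all $A\subset\Omega^N$) are measurable up to null sets, or $\Omega$ is a standard Borel space, and then no further measurability is assumed. (2) The function $h(x,y)=\min(|x-y|,|x-y|^2)$ on $\mathbb R^2$ is a penalty that satisfies $(\ast)$ with respect to $\nu_1$, so that the inequality of (1) holds for it. (3) Let $\mu$ be a probability measure on $\Omega$ and $h$ a function on $\Omega^2$ that satisfy $(\ast)$, let $\eta:\Omega\to\Omega'$ be a measurable map, let $\mu'=\eta(\mu)$ be the image measure, and let $h'\ge0$ be a function on $\Omega'^2$ with $h'(\eta(x),\eta(y))\le h(x,y)$ for all $x,y\in\Omega$. Then $(\mu',h')$ satisfies $(\ast)$, where $\mu$ and $\mu'$ of sets that might not be measurable are outer measures. (4) Let $\psi\ge0$ be a convex symmetric function on $\mathbb R$ with $\lim_{x\to\infty}\psi'(x)=\infty$ (right derivative), and let $\nu_\psi$ be the probability measure with density $a_\psi e^{-\psi(x)}$, where $a_\psi$ is the normalizing constant. Then there is a constant $C>0$, depending on $\psi$ only, such that the function $$h(x,y)=\tfrac1C|x-y|^2\ \text{ if }|x-y|\le1,\qquad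 h(x,y)=\tfrac1C\,\psi\!\left(\tfrac1C|x-y|\right)\ \text{ if }|x-y|>1,$$ is a penalty that satisfies $(\ast)$ with respect to $\nu_\psi$, so that the inequality of (1) holds for it, with the same universal constant $K$. -/

import Mathlib

open MeasureTheory Set Filter

universe u v

namespace Penalty

/-- The two-sided exponential law `ν₁` on `ℝ`, with density `(1/2) * exp (-|x|)`. -/
noncomputable def nuOne : Measure ℝ :=
  volume.withDensity fun x => ENNReal.ofReal (1 / 2 * Real.exp (-|x|))

/-- The concentration function `c(a, t) = ν₁((-∞, b + t])`, where `b` is given by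
`a = ν₁((-∞, b])`. For `0 < a < 1` there is exactly one such `b`, so the supremum runs over a
single value; the function is only used for such `a`, and for `t > 0`. -/
noncomputable def conc (a : ENNReal) (t : ℝ) : ENNReal :=
  ⨆ (b : ℝ) (_ : nuOne (Iic b) = a), nuOne (Iic (b + t))

section

variable {Ω : Type*}

/-- `h(ω, B) = inf {h(ω, ω') : ω' ∈ B}`, for a penalty `h ≥ 0`. (It is only used for sets `B` of
positive measure, so that `B` is not empty.) -/
noncomputable def toSet (h : Ω → Ω → ℝ) (ω : Ω) (B : Set Ω) : ℝ :=
  ⨅ y : B, h ω y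

/-- `f_h(A, x) = inf {∑ i, h(x i, y i) : y ∈ A}` for `A ⊆ Ω^N`, `x ∈ Ω^N`. (The value at `A = ∅`,
a set of measure zero, plays no role.) -/
noncomputable def f {N : ℕ} (h : Ω → Ω → ℝ) (A : Set (Fin N → Ω)) (x : Fin N → Ω) : ℝ :=
  ⨅ y : A, ∑ i, h (x i) ((y : Fin N → Ω) i)

variable [MeasurableSpace Ω]

/-- Standing assumptions on a penalty function: measurable, nonnegative, zero on the diagonal. -/
structure IsPenalty (h : Ω → Ω → ℝ) : Prop where
  measurable : Measurable fun p : Ω × Ω => h p.1 p.2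
  nonneg : ∀ x y, 0 ≤ h x y
  diag : ∀ x, h x x = 0

/-- The one-dimensional concentration conditions: for every measurable `B` (with `0 < μ B < 1`,
the range on which `c(μ B, ·)` is defined) and every `t > 0`,
`μ {h(·, B) ≤ t²} ≥ c(μ B, t)` if `t ≤ 1`, and `μ {h(·, B) ≤ t} ≥ c(μ B, t)` if `t ≥ 1`. -/
structure Concentrates (μ : Measure Ω) (h : Ω → Ω → ℝ) : Prop where
  small : ∀ B : Set Ω, MeasurableSet B → 0 < μ B → μ B < 1 → ∀ t : ℝ, 0 < t → t ≤ 1 →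
    conc (μ B) t ≤ μ {x | toSet h x B ≤ t ^ 2}
  large : ∀ B : Set Ω, MeasurableSet B → 0 < μ B → μ B < 1 → ∀ t : ℝ, 1 ≤ t →
    conc (μ B) t ≤ μ {x | toSet h x B ≤ t}

/-- The upper integral `∫^* g dμ`: the infimum of the integrals of the measurable majorants of `g`.
It is the usual integral `∫ g dμ` if `g` is measurable. -/
noncomputable def upperIntegral (μ : Measure Ω) (g : Ω → ENNReal) : ENNReal :=
  ⨅ (G : Ω → ENNReal) (_ : Measurable G) (_ : g ≤ G), ∫⁻ x, G x ∂μ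

/-- The functions `f_h(A, ·)` are measurable up to null sets, for every `N` and every measurable
`A ⊆ Ω^N`. (For `N = 1`, this is the measurability of `h(·, B)`, for every measurable `B`.) -/
def MeasurabilityConvention (μ : Measure Ω) (h : Ω → Ω → ℝ) : Prop :=
  ∀ (N : ℕ) (A : Set (Fin N → Ω)), MeasurableSet A →
    AEMeasurable (fun x => f h A x) (Measure.pi fun _ : Fin N => μ)

/-- The product inequality with constant `K`: for every `N` and every measurable `A ⊆ Ω^N`,
`∫ exp (f_h(A, x) / K) dP(x) ≤ 1 / P(A)`, where `P` is the product measure `μ^N`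
(with `1 / 0 = ∞`). -/
def ProductBound (μ : Measure Ω) (h : Ω → Ω → ℝ) (K : ℝ) : Prop :=
  ∀ (N : ℕ) (A : Set (Fin N → Ω)), MeasurableSet A →
    upperIntegral (Measure.pi fun _ : Fin N => μ)
        (fun x => ENNReal.ofReal (Real.exp (K⁻¹ * f h A x))) ≤
      1 / (Measure.pi fun _ : Fin N => μ) A

end

/-- The function `min (|x - y|, |x - y|²)` on `ℝ × ℝ`. -/
noncomputable def hOne (x y : ℝ) : ℝ := min |x - y| (|x - y| ^ 2)

/-- The measure `ν_ψ` on `ℝ` with density `a_ψ exp (-ψ)`, where `a_ψ = (∫ exp (-ψ))⁻¹`. -/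
noncomputable def nuPsi (ψ : ℝ → ℝ) : Measure ℝ :=
  volume.withDensity fun x => ENNReal.ofReal ((∫ z, Real.exp (-ψ z))⁻¹ * Real.exp (-ψ x))

/-- `|x - y|² / C` at distance at most `1`, and `ψ (|x - y| / C) / C` at distance more than `1`. -/
noncomputable def hPsi (ψ : ℝ → ℝ) (C : ℝ) (x y : ℝ) : ℝ :=
  if |x - y| ≤ 1 then 1 / C * |x - y| ^ 2 else 1 / C * ψ (1 / C * |x - y|)

end Penalty

/-!
The inequality `ProductBound` is an infimum-convolution inequality (Maurey's property `(τ)`) in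
disguise.
Integrating over one coordinate at a time, it follows by induction on `N` once one knows that, for
a measurable `g` with values in `[0, 1]` (the measure of a section of `A`),
`∫ inf_{ω'} (exp (h (ω, ω') / K) / g ω') dμ(ω) ≤ 1 / ∫ g dμ`; this is
`lintegral_mul_lintegral_le`.

The condition `Concentrates` says that enlargements of sets in `Ω` have at least the measure of the
corresponding enlargements of half-lines under `nuOne`. Hence the last inequality reduces to its
special case for monotone functions on the line, by passing from `-log g` to its increasing
rearrangement (`lintegral_le_lintegral_rearr`, `lintegral_le_lintegral_infConv_rearr`). Half of the
cost, the linear one, is spent on making the rearrangement `ψ` Lipschitz with a small constant.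

On the line one may assume `ψ 0 = 0`, and by the arithmetic-geometric mean inequality it is enough
that `∫ (exp w + exp (-ψ)) dν₁ ≤ 2`, where `w` is the infimum-convolution of `ψ` with the quadratic
cost (`lintegral_expSum_le`). On a unit interval where `ψ` has the increment `D`, the average of
`ψ - w` is at least a large multiple of `D²` (`sq_increment_le_integral`), while `2 cosh ψ - 2`
grows at most by a factor `2 < e` and a term of order `D²` (`cosh_add_le`), so that the estimates
over the unit intervals on either side of the origin telescope.

If `Ω` is standard Borel, the sublevel sets of `f_h(A, ·)` are analytic, hence measurable up to null
sets for every finite measure (`nullMeasurableSet_of_analyticSet`).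

That `ν₁` concentrates with respect to `hOne` is `nuOne_Iic_add_le_enlargement`: until a set has
been enlarged so far that it reaches the origin, its measure grows at least like `e ^ t`, and afterwards that of its
complement decays at least like `e ^ (-t)`, whereas half-lines grow at most at these rates.
The log-concave law `ν_ψ` is the image of `ν₁` under the increasing rearrangement; superadditivity
of `ψ - ψ 0` on `[0, ∞)` bounds the tails of `ν_ψ` and thereby the increments of that map
(`toExp_sub_ge`).
-/

/-! ### The two-sided exponential law -/

namespace Penalty

/-- The distribution function of `nuOne`, in closed form. -/
noncomputable def expCdf (x : ℝ) : ℝ :=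
  if x ≤ 0 then Real.exp x / 2 else 1 - Real.exp (-x) / 2

lemma expCdf_of_nonpos {x : ℝ} (hx : x ≤ 0) : expCdf x = Real.exp x / 2 := by
  simp [expCdf, hx]

lemma expCdf_of_nonneg {x : ℝ} (hx : 0 ≤ x) : expCdf x = 1 - Real.exp (-x) / 2 := by
  rcases hx.eq_or_lt with rfl | hx
  · norm_num [expCdf]
  · simp [expCdf, not_le.2 hx]

lemma expCdf_neg (x : ℝ) : expCdf (-x) = 1 - expCdf x := by
  rcases le_total x 0 with hx | hx
  · rw [expCdf_of_nonneg (by linarith), expCdf_of_nonpos hx, neg_neg]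
  · rw [expCdf_of_nonneg hx, expCdf_of_nonpos (by linarith)]; ring

lemma expCdf_strictMono : StrictMono expCdf := by
  intro x y hxy
  rcases le_total y 0 with hy | hy
  · rw [expCdf_of_nonpos hy, expCdf_of_nonpos (by linarith)]
    linarith [Real.exp_lt_exp.2 hxy]
  rcases le_total x 0 with hx | hx
  · rw [expCdf_of_nonneg hy, expCdf_of_nonpos hx]
    have h1 := Real.exp_le_one_iff.2 hx
    have h2 : Real.exp (-y) ≤ 1 := Real.exp_le_one_iff.2 (by linarith)
    rcases hy.eq_or_lt with rfl | hy'
    · have : Real.exp x < 1 := by simpa using Real.exp_lt_exp.2 hxy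
      rw [neg_zero, Real.exp_zero]
      linarith
    · have : Real.exp (-y) < 1 := by simpa using hy'
      linarith
  · rw [expCdf_of_nonneg hy, expCdf_of_nonneg hx]
    linarith [Real.exp_lt_exp.2 (neg_lt_neg hxy)]

lemma expCdf_pos (x : ℝ) : 0 < expCdf x := by
  rcases le_total x 0 with hx | hx
  · rw [expCdf_of_nonpos hx]; positivity
  · rw [expCdf_of_nonneg hx]
    have : Real.exp (-x) ≤ 1 := Real.exp_le_one_iff.2 (by linarith)
    linarith

lemma expCdf_lt_one (x : ℝ) : expCdf x < 1 := by
  have := expCdf_pos (-x)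
  rw [expCdf_neg] at this
  linarith

lemma exists_expCdf_eq {p : ℝ} (h0 : 0 < p) (h1 : p < 1) : ∃ b, expCdf b = p := by
  rcases le_total p (1 / 2) with hp | hp
  · refine ⟨Real.log (2 * p), ?_⟩
    rw [expCdf_of_nonpos (Real.log_nonpos (by linarith) (by linarith)),
      Real.exp_log (by linarith)]
    ring
  · refine ⟨-Real.log (2 * (1 - p)), ?_⟩
    have := Real.log_nonpos (x := 2 * (1 - p)) (by linarith) (by linarith)
    rw [expCdf_of_nonneg (by linarith), neg_neg, Real.exp_log (by linarith)]
    ring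

lemma expCdf_add_le (b : ℝ) {r : ℝ} (hr : 0 ≤ r) :
    expCdf (b + r) ≤ Real.exp r * expCdf b := by
  have h1 : 1 ≤ Real.exp r := Real.one_le_exp hr
  rcases le_total (b + r) 0 with h | h
  · rw [expCdf_of_nonpos h, expCdf_of_nonpos (by linarith), Real.exp_add]
    linarith
  rcases le_total b 0 with hb | hb
  · rw [expCdf_of_nonneg h, expCdf_of_nonpos hb]
    have h2 : Real.exp r * Real.exp b = Real.exp (b + r) := by rw [Real.exp_add]; ring
    -- `1 - e⁻ˢ / 2 ≤ eˢ / 2` with `s = b + r`, by the arithmetic-geometric mean inequality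
    have h3 : Real.exp (b + r) * Real.exp (-(b + r)) = 1 := by rw [← Real.exp_add]; simp
    nlinarith [sq_nonneg (Real.exp (b + r) - Real.exp (-(b + r))), Real.exp_pos (b + r),
      Real.exp_pos (-(b + r))]
  · rw [expCdf_of_nonneg h, expCdf_of_nonneg hb]
    have h2 : Real.exp (-b) = Real.exp r * Real.exp (-(b + r)) := by
      rw [← Real.exp_add]; congr 1; ring
    have h3 : Real.exp (-b) ≤ 1 := Real.exp_le_one_iff.2 (by linarith)
    have h4 := Real.exp_pos (-(b + r))
    rw [h2] at h3 ⊢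
    have h5 : Real.exp (-(b + r)) ≤ 1 := Real.exp_le_one_iff.2 (by linarith)
    nlinarith [mul_nonneg (sub_nonneg.2 h1) (show 0 ≤ 1 - (Real.exp r * Real.exp (-(b + r)) +
      Real.exp (-(b + r))) / 2 by linarith)]

lemma one_sub_expCdf_le (b : ℝ) {r : ℝ} (hr : 0 ≤ r) :
    1 - expCdf b ≤ Real.exp r * (1 - expCdf (b + r)) := by
  have := expCdf_add_le (-(b + r)) hr
  rwa [show -(b + r) + r = -b by ring, expCdf_neg, expCdf_neg] at this

lemma nuOne_apply {s : Set ℝ} (hs : MeasurableSet s) :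
    nuOne s = ∫⁻ x in s, ENNReal.ofReal (1 / 2 * Real.exp (-|x|)) :=
  withDensity_apply _ hs

lemma nuOne_Iic_of_nonpos {b : ℝ} (hb : b ≤ 0) :
    nuOne (Iic b) = ENNReal.ofReal (Real.exp b / 2) := by
  rw [nuOne_apply measurableSet_Iic]
  have h1 : ∫⁻ x in Iic b, ENNReal.ofReal (1 / 2 * Real.exp (-|x|)) =
      ∫⁻ x in Iic b, ENNReal.ofReal (1 / 2 * Real.exp x) := by
    refine setLIntegral_congr_fun measurableSet_Iic fun x hx => ?_
    simp only [abs_of_nonpos ((mem_Iic.1 hx).trans hb), neg_neg]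
  rw [h1, ← ofReal_integral_eq_lintegral_ofReal, integral_const_mul, integral_exp_Iic]
  · congr 1; ring
  · exact ((integrableOn_exp_Iic b).const_mul _)
  · exact Eventually.of_forall fun x => by positivity

lemma nuOne_Ioi_of_nonneg {b : ℝ} (hb : 0 ≤ b) :
    nuOne (Ioi b) = ENNReal.ofReal (Real.exp (-b) / 2) := by
  rw [nuOne_apply measurableSet_Ioi]
  have h1 : ∫⁻ x in Ioi b, ENNReal.ofReal (1 / 2 * Real.exp (-|x|)) =
      ∫⁻ x in Ioi b, ENNReal.ofReal (1 / 2 * Real.exp (-x)) := by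
    refine setLIntegral_congr_fun measurableSet_Ioi fun x hx => ?_
    simp only [abs_of_nonneg (hb.trans (mem_Ioi.1 hx).le)]
  rw [h1, ← ofReal_integral_eq_lintegral_ofReal, integral_const_mul, integral_exp_neg_Ioi]
  · congr 1; ring
  · exact ((integrableOn_exp_neg_Ioi b).const_mul _)
  · exact Eventually.of_forall fun x => by positivity

instance isProbabilityMeasure_nuOne : IsProbabilityMeasure nuOne := by
  refine ⟨?_⟩
  have h := measure_union (μ := nuOne) (Set.Iic_disjoint_Ioi (le_refl (0 : ℝ)))
    measurableSet_Ioi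
  rw [Iic_union_Ioi, nuOne_Iic_of_nonpos le_rfl, nuOne_Ioi_of_nonneg le_rfl,
    ← ENNReal.ofReal_add (by positivity) (by positivity)] at h
  rw [h]
  norm_num

lemma nuOne_Iic (b : ℝ) : nuOne (Iic b) = ENNReal.ofReal (expCdf b) := by
  rcases le_total b 0 with hb | hb
  · rw [nuOne_Iic_of_nonpos hb, expCdf_of_nonpos hb]
  · rw [← compl_Ioi, prob_compl_eq_one_sub measurableSet_Ioi, nuOne_Ioi_of_nonneg hb,
      expCdf_of_nonneg hb, ENNReal.ofReal_sub _ (by positivity), ENNReal.ofReal_one]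

lemma exists_nuOne_Iic_eq {p : ENNReal} (h0 : 0 < p) (h1 : p < 1) :
    ∃ b, nuOne (Iic b) = p := by
  have hp : p ≠ ⊤ := (h1.trans ENNReal.one_lt_top).ne
  obtain ⟨b, hb⟩ := exists_expCdf_eq (p := p.toReal) (ENNReal.toReal_pos h0.ne' hp)
    (by simpa using (ENNReal.toReal_lt_toReal hp ENNReal.one_ne_top).2 h1)
  exact ⟨b, by rw [nuOne_Iic, hb, ENNReal.ofReal_toReal hp]⟩

lemma nuOne_Iic_le_iff {x y : ℝ} : nuOne (Iic x) ≤ nuOne (Iic y) ↔ x ≤ y := by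
  rw [nuOne_Iic, nuOne_Iic, ENNReal.ofReal_le_ofReal_iff (expCdf_pos y).le,
    expCdf_strictMono.le_iff_le]

lemma nuOne_Iic_pos (x : ℝ) : 0 < nuOne (Iic x) := by
  rw [nuOne_Iic]; exact ENNReal.ofReal_pos.2 (expCdf_pos x)

lemma conc_nuOne_Iic (b t : ℝ) : conc (nuOne (Iic b)) t = nuOne (Iic (b + t)) := by
  refine le_antisymm (iSup₂_le fun c hc => ?_) (le_iSup₂_of_le b rfl le_rfl)
  have : c = b := le_antisymm (nuOne_Iic_le_iff.1 hc.le) (nuOne_Iic_le_iff.1 hc.ge)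
  rw [this]

/-- A translation that lowers `|x|` by `s` on all of `E` multiplies the mass of `E` by `e ^ s`. -/
lemma nuOne_preimage_add {E : Set ℝ} (hE : MeasurableSet E) {r s : ℝ}
    (h : ∀ x ∈ E, |x - r| = |x| - s) :
    nuOne ((fun x => x + r) ⁻¹' E) = ENNReal.ofReal (Real.exp s) * nuOne E := by
  have hE' : MeasurableSet ((fun x => x + r) ⁻¹' E) := hE.preimage (measurable_add_const r)
  rw [nuOne_apply hE, nuOne_apply hE',
    ← lintegral_const_mul _ (by fun_prop), ← lintegral_indicator hE,
    ← lintegral_indicator hE',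
    ← lintegral_add_right_eq_self (E.indicator _) r]
  refine lintegral_congr fun x => ?_
  by_cases hx : x + r ∈ E
  · rw [indicator_of_mem (show x ∈ (fun x => x + r) ⁻¹' E from hx), indicator_of_mem hx,
      ← ENNReal.ofReal_mul (Real.exp_pos _).le]
    have := h _ hx
    rw [add_sub_cancel_right] at this
    rw [this, show -(|x + r| - s) = s + -|x + r| by ring, Real.exp_add]
    congr 1; ring
  · rw [indicator_of_notMem (show x ∉ (fun x => x + r) ⁻¹' E from hx), indicator_of_notMem hx]

end Penalty

/-! ### Enlargements of sets of reals under the exponential law -/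

namespace Penalty

/-- Pushing the part of `B` on either side of `(-r, r)` towards the origin by `r`. -/
def pushInward (B : Set ℝ) (r : ℝ) : Set ℝ :=
  (fun x => x + r) ⁻¹' (B ∩ Ici r) ∪ (fun x => x + -r) ⁻¹' (B ∩ Iic (-r))

lemma measurableSet_pushInward {B : Set ℝ} (hB : MeasurableSet B) (r : ℝ) :
    MeasurableSet (pushInward B r) :=
  ((hB.inter measurableSet_Ici).preimage (measurable_add_const r)).union
    ((hB.inter measurableSet_Iic).preimage (measurable_add_const (-r)))

lemma exists_of_mem_pushInward {B : Set ℝ} {r x : ℝ} (hr : 0 ≤ r) (hx : x ∈ pushInward B r) :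
    ∃ y ∈ B, |x - y| ≤ r := by
  rcases hx with ⟨h, -⟩ | ⟨h, -⟩
  · exact ⟨x + r, h, by rw [abs_le]; constructor <;> linarith⟩
  · exact ⟨x + -r, h, by rw [abs_le]; constructor <;> linarith⟩

lemma nuOne_singleton (x : ℝ) : nuOne {x} = 0 :=
  withDensity_absolutelyContinuous _ _ Real.volume_singleton

/-- A set that avoids `(-r, r)` gains at least a factor `e ^ r` when pushed inward by `r`. -/
lemma nuOne_pushInward {B : Set ℝ} (hB : MeasurableSet B) {r : ℝ} (hr : 0 < r)
    (h : ∀ x ∈ B, r ≤ |x|) :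
    nuOne (pushInward B r) = ENNReal.ofReal (Real.exp r) * nuOne B := by
  have hP : MeasurableSet (B ∩ Ici r) := hB.inter measurableSet_Ici
  have hN : MeasurableSet (B ∩ Iic (-r)) := hB.inter measurableSet_Iic
  -- the two pieces meet in the origin at most
  have hae : AEDisjoint nuOne ((fun x => x + r) ⁻¹' (B ∩ Ici r))
      ((fun x => x + -r) ⁻¹' (B ∩ Iic (-r))) := by
    refine measure_mono_null (t := {0}) ?_ (nuOne_singleton 0)
    rintro x ⟨⟨-, h1⟩, -, h2⟩
    rw [mem_Ici] at h1
    rw [mem_Iic] at h2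
    rw [mem_singleton_iff]
    linarith
  have hd : Disjoint (B ∩ Ici r) (B ∩ Iic (-r)) := by
    rw [Set.disjoint_left]
    rintro x ⟨-, h1⟩ ⟨-, h2⟩
    rw [mem_Ici] at h1
    rw [mem_Iic] at h2
    linarith
  have hBeq : B = (B ∩ Ici r) ∪ (B ∩ Iic (-r)) := by
    ext x
    constructor
    · intro hx
      rcases le_abs.1 (h x hx) with h1 | h1
      · exact Or.inl ⟨hx, h1⟩
      · exact Or.inr ⟨hx, show x ≤ -r by linarith⟩
    · rintro (h | h) <;> exact h.1
  rw [pushInward, measure_union₀ (hN.preimage (measurable_add_const (-r))).nullMeasurableSet hae,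
    nuOne_preimage_add hP (s := r), nuOne_preimage_add hN (s := r), ← mul_add,
    ← measure_union hd hN, ← hBeq]
  · rintro x ⟨-, hx⟩
    rw [mem_Iic] at hx
    rw [abs_of_nonpos (by linarith), abs_of_nonpos (by linarith)]
    ring
  · rintro x ⟨-, hx⟩
    rw [mem_Ici] at hx
    rw [abs_of_nonneg (by linarith), abs_of_nonneg (by linarith)]

/-- Once the origin is reached, the complement of an enlargement decays exponentially. -/
lemma nuOne_compl_le_of_push {V W : Set ℝ} (hW : MeasurableSet W)
    {r : ℝ} (hr : 0 < r) (h0 : ∀ x, |x| < r → x ∈ W)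
    (hVW : ∀ x, (∃ y ∈ V, |x - y| ≤ r) → x ∈ W) :
    ENNReal.ofReal (Real.exp r) * nuOne Wᶜ ≤ nuOne Vᶜ := by
  rw [← nuOne_pushInward hW.compl hr fun x hx => not_lt.1 fun h => hx (h0 x h)]
  refine measure_mono fun x hx hxV => ?_
  obtain ⟨y, hy, hxy⟩ := exists_of_mem_pushInward hr.le hx
  exact hy (hVW y ⟨x, hxV, by rwa [abs_sub_comm]⟩)

/-- Half-lines are extremal for the enlargement of sets of reals: if the mass of `B` is that of
`(-∞, b]`, then the `t`-enlargement of `B` has at least the mass of `(-∞, b + t]`. -/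
lemma nuOne_Iic_add_le_enlargement {B : Set ℝ} (hB : MeasurableSet B) {b t : ℝ}
    (hb : nuOne (Iic b) = nuOne B) (ht : 0 < t) :
    nuOne (Iic (b + t)) ≤ nuOne {x | ∃ y ∈ B, |x - y| ≤ t} := by
  have hne : B.Nonempty := by
    refine nonempty_of_measure_ne_zero (μ := nuOne) ?_
    rw [← hb]; exact (nuOne_Iic_pos b).ne'
  set S : Set ℝ := (fun y => |y|) '' B with hS
  have hSne : S.Nonempty := hne.image _
  have hSbdd : BddBelow S := ⟨0, by rintro _ ⟨y, -, rfl⟩; exact abs_nonneg y⟩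
  set τ : ℝ := sInf S with hτ
  have hτ0 : 0 ≤ τ := Real.sInf_nonneg (by rintro _ ⟨y, -, rfl⟩; exact abs_nonneg y)
  have hτle : ∀ x ∈ B, τ ≤ |x| := fun x hx => csInf_le hSbdd ⟨x, hx, rfl⟩
  have hmul : ∀ r : ℝ, 0 ≤ r →
      nuOne (Iic (b + r)) ≤ ENNReal.ofReal (Real.exp r) * nuOne B := by
    intro r hr
    rw [← hb, nuOne_Iic, nuOne_Iic, ← ENNReal.ofReal_mul (Real.exp_pos r).le]
    exact ENNReal.ofReal_le_ofReal (expCdf_add_le b hr)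
  rcases le_or_gt t τ with htτ | htτ
  · refine (hmul t ht.le).trans ?_
    rw [← nuOne_pushInward hB ht fun x hx => htτ.trans (hτle x hx)]
    exact measure_mono fun x hx => exists_of_mem_pushInward ht.le hx
  -- `V` is the `τ`-enlargement at which the origin is reached, up to null sets
  obtain ⟨V, hV, hVB, hVm⟩ : ∃ V : Set ℝ, MeasurableSet V ∧
      (∀ x ∈ V, ∃ y ∈ B, |x - y| ≤ τ) ∧ nuOne (Iic (b + τ)) ≤ nuOne V := by
    rcases hτ0.eq_or_lt with h0 | h0
    · refine ⟨B, hB, fun x hx => ⟨x, hx, by simp [hτ0]⟩, ?_⟩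
      rw [← h0, add_zero, hb]
    · refine ⟨pushInward B τ, measurableSet_pushInward hB τ,
        fun x hx => exists_of_mem_pushInward hτ0 hx, ?_⟩
      rw [nuOne_pushInward hB h0 hτle]
      exact hmul τ hτ0
  set r : ℝ := t - τ with hr
  have hr0 : 0 < r := sub_pos.2 htτ
  set W : Set ℝ := toMeasurable nuOne {x | ∃ y ∈ B, |x - y| ≤ t} with hW
  have hWsub : {x | ∃ y ∈ B, |x - y| ≤ t} ⊆ W := subset_toMeasurable _ _
  have hWm : MeasurableSet W := measurableSet_toMeasurable _ _
  have key := nuOne_compl_le_of_push hWm hr0 (by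
      intro x hx
      obtain ⟨_, ⟨y, hy, rfl⟩, hyτ⟩ := exists_lt_of_csInf_lt hSne
        (show sInf S < t - |x| by linarith)
      refine hWsub ⟨y, hy, (abs_sub x y).trans ?_⟩
      dsimp only at hyτ
      linarith) (by
      rintro x ⟨y, hy, hxy⟩
      obtain ⟨z, hz, hyz⟩ := hVB y hy
      exact hWsub ⟨z, hz, (abs_sub_le x y z).trans (by linarith)⟩)
  rw [← measure_toMeasurable {x | ∃ y ∈ B, |x - y| ≤ t}, ← hW]
  have hVc : nuOne Vᶜ ≤ ENNReal.ofReal (1 - expCdf (b + τ)) := by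
    rw [prob_compl_eq_one_sub hV, ENNReal.ofReal_sub _ (expCdf_pos _).le, ENNReal.ofReal_one,
      ← nuOne_Iic]
    exact tsub_le_tsub_left hVm _
  have hWc : nuOne Wᶜ ≤ ENNReal.ofReal (1 - expCdf (b + t)) := by
    have h1 := key.trans hVc
    have h2 := one_sub_expCdf_le (b + τ) hr0.le
    rw [show b + τ + r = b + t by rw [hr]; ring] at h2
    have h3 := h1.trans (ENNReal.ofReal_le_ofReal h2)
    rw [ENNReal.ofReal_mul (Real.exp_pos r).le] at h3
    exact (ENNReal.mul_le_mul_iff_right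
      (ENNReal.ofReal_pos.2 (Real.exp_pos r)).ne' ENNReal.ofReal_ne_top).1 h3
  rw [← compl_compl W, prob_compl_eq_one_sub hWm.compl, nuOne_Iic]
  refine le_trans ?_ (tsub_le_tsub_left hWc _)
  rw [← ENNReal.ofReal_one, ← ENNReal.ofReal_sub _ (by linarith [expCdf_lt_one (b + t)])]
  exact ENNReal.ofReal_le_ofReal (by linarith)

lemma toSet_le {Ω : Type*} {h : Ω → Ω → ℝ} (hnn : ∀ x y, 0 ≤ h x y) {B : Set Ω} {x y : Ω}
    (hy : y ∈ B) : toSet h x B ≤ h x y :=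
  ciInf_le (f := fun y : B => h x y) ⟨0, by rintro _ ⟨z, rfl⟩; exact hnn _ _⟩ ⟨y, hy⟩

lemma isPenalty_hOne : IsPenalty hOne where
  measurable := by unfold hOne; fun_prop
  nonneg x y := le_min (abs_nonneg _) (by positivity)
  diag x := by simp [hOne]

lemma concentrates_nuOne_hOne : Concentrates nuOne hOne := by
  have key : ∀ B : Set ℝ, MeasurableSet B → 0 < nuOne B → nuOne B < 1 → ∀ t c : ℝ, 0 < t →
      (∀ x y : ℝ, |x - y| ≤ t → hOne x y ≤ c) →
      conc (nuOne B) t ≤ nuOne {x | toSet hOne x B ≤ c} := by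
    intro B hB h0 h1 t c ht hc
    obtain ⟨b, hb⟩ := exists_nuOne_Iic_eq h0 h1
    rw [← hb, conc_nuOne_Iic]
    refine (nuOne_Iic_add_le_enlargement hB hb ht).trans (measure_mono ?_)
    rintro x ⟨y, hy, hxy⟩
    exact (toSet_le isPenalty_hOne.nonneg hy).trans (hc x y hxy)
  refine ⟨fun B hB h0 h1 t ht _ => key B hB h0 h1 t _ ht fun x y hxy => ?_,
    fun B hB h0 h1 t ht => key B hB h0 h1 t _ (by linarith) fun x y hxy => ?_⟩
  · exact (min_le_right _ _).trans (pow_le_pow_left₀ (abs_nonneg _) hxy 2)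
  · exact (min_le_left _ _).trans hxy

/-! ### Images under maps that do not increase the penalty -/

lemma Concentrates.map {Ω : Type u} {Ω' : Type v} [MeasurableSpace Ω] [MeasurableSpace Ω']
    {μ : Measure Ω} {h : Ω → Ω → ℝ} {η : Ω → Ω'} {h' : Ω' → Ω' → ℝ} (hη : Measurable η)
    (hnn : ∀ x y, 0 ≤ h' x y) (hle : ∀ x y, h' (η x) (η y) ≤ h x y) (H : Concentrates μ h) :
    Concentrates (μ.map η) h' := by
  have key : ∀ (B : Set Ω') (c : ℝ), 0 < μ (η ⁻¹' B) →
      μ {x | toSet h x (η ⁻¹' B) ≤ c} ≤ μ.map η {x | toSet h' x B ≤ c} := by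
    intro B c h0
    refine le_trans (measure_mono fun x hx => ?_) (Measure.le_map_apply hη.aemeasurable _)
    have hne : Nonempty (η ⁻¹' B) := (nonempty_of_measure_ne_zero h0.ne').to_subtype
    refine le_trans (le_ciInf fun y => ?_) (mem_ofPred.1 hx)
    exact (toSet_le hnn (show η y ∈ B from y.2)).trans (hle x y)
  constructor
  · intro B hB h0 h1 t ht ht1
    rw [Measure.map_apply hη hB] at *
    exact (H.small _ (hη hB) h0 h1 t ht ht1).trans (key B _ h0)
  · intro B hB h0 h1 t ht
    rw [Measure.map_apply hη hB] at *
    exact (H.large _ (hη hB) h0 h1 t ht).trans (key B _ h0)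

end Penalty

/-! ### Log-concave laws as images of the exponential law -/

namespace Penalty

section LogConcave

variable {ψ : ℝ → ℝ}

lemma continuous_of_convexOn (hc : ConvexOn ℝ univ ψ) : Continuous ψ :=
  continuousOn_univ.1 (hc.continuousOn isOpen_univ)

/-- A convex function on the line is superadditive on `[0, ∞)`, up to its value at the origin. -/
lemma add_le_of_convexOn (hc : ConvexOn ℝ univ ψ) {u w : ℝ} (hu : 0 ≤ u) (hw : 0 ≤ w) :
    ψ u + ψ w ≤ ψ (u + w) + ψ 0 := by
  rcases (add_nonneg hu hw).eq_or_lt with h | h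
  · obtain rfl : u = 0 := by linarith
    obtain rfl : w = 0 := by linarith
    simp
  have key : ∀ a b : ℝ, 0 ≤ a → 0 ≤ b → a + b = u + w →
      ψ a ≤ a / (u + w) * ψ (u + w) + b / (u + w) * ψ 0 := by
    intro a b ha hb hab
    have := hc.2 (mem_univ (u + w)) (mem_univ 0) (div_nonneg ha h.le) (div_nonneg hb h.le)
      (by rw [← add_div, hab, div_self h.ne'])
    simpa [smul_eq_mul, div_mul_cancel₀ _ h.ne'] using this
  have h1 := key u w hu hw rfl
  have h2 := key w u hw hu (add_comm _ _)
  have h3 : u / (u + w) + w / (u + w) = 1 := by rw [← add_div, div_self h.ne']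
  linear_combination h1 + h2 + (ψ (u + w) + ψ 0) * h3

lemma le_of_convexOn_of_even (hc : ConvexOn ℝ univ ψ) (he : ∀ x, ψ (-x) = ψ x) (x : ℝ) :
    ψ 0 ≤ ψ x := by
  have := hc.2 (mem_univ x) (mem_univ (-x)) (show (0 : ℝ) ≤ 1 / 2 by norm_num)
    (show (0 : ℝ) ≤ 1 / 2 by norm_num) (by norm_num)
  rw [smul_neg, add_neg_cancel, he, smul_eq_mul] at this
  linarith

lemma mono_of_convexOn_of_even (hc : ConvexOn ℝ univ ψ) (he : ∀ x, ψ (-x) = ψ x) {x y : ℝ}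
    (hx : 0 ≤ x) (hxy : x ≤ y) : ψ x ≤ ψ y := by
  have h1 := add_le_of_convexOn hc hx (sub_nonneg.2 hxy)
  have h2 := le_of_convexOn_of_even hc he (y - x)
  rw [add_sub_cancel] at h1
  linarith

lemma exists_lt_of_tendsto_derivWithin (hc : ConvexOn ℝ univ ψ) (he : ∀ x, ψ (-x) = ψ x)
    (hd : Tendsto (fun x => derivWithin ψ (Ioi x) x) atTop atTop) :
    ∃ x, 0 < x ∧ ψ 0 < ψ x := by
  by_contra! h
  have hconst : ∀ x, 0 < x → ψ x = ψ 0 := fun x hx =>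
    le_antisymm (h x hx) (le_of_convexOn_of_even hc he x)
  obtain ⟨x, hx0, hx1⟩ := ((eventually_gt_atTop (0 : ℝ)).and
    (hd.eventually_ge_atTop 1)).exists
  have : derivWithin ψ (Ioi x) x = derivWithin (fun _ => ψ 0) (Ioi x) x :=
    derivWithin_congr (fun y hy => hconst y (hx0.trans hy)) (hconst x hx0)
  rw [this, derivWithin_fun_const, Pi.zero_apply] at hx1
  norm_num at hx1

lemma integrable_exp_neg_mul_abs {c : ℝ} (hc : 0 < c) :
    Integrable fun x : ℝ => Real.exp (-(c * |x|)) := by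
  have h1 : Integrable fun x : ℝ => Real.exp (-|x|) := by
    rw [← integrableOn_univ, ← Iic_union_Ioi (a := (0 : ℝ))]
    refine IntegrableOn.union ?_ ?_
    · refine (integrableOn_exp_Iic 0).congr_fun (fun x hx => ?_) measurableSet_Iic
      simp only [abs_of_nonpos (mem_Iic.1 hx), neg_neg]
    · refine (integrableOn_exp_neg_Ioi 0).congr_fun (fun x hx => ?_) measurableSet_Ioi
      simp only [abs_of_pos (mem_Ioi.1 hx)]
  have h2 := h1.comp_mul_left' hc.ne'
  simpa [abs_mul, abs_of_pos hc] using h2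

/-- Convexity makes `ψ` grow at least linearly, so that `exp (-ψ)` is integrable. -/
lemma integrable_exp_neg_of_convexOn (hc : ConvexOn ℝ univ ψ) (he : ∀ x, ψ (-x) = ψ x)
    {x₁ : ℝ} (hx₁ : 0 < x₁) (hψ : ψ 0 < ψ x₁) : Integrable fun x => Real.exp (-ψ x) := by
  set c : ℝ := (ψ x₁ - ψ 0) / x₁ with hcdef
  have hc0 : 0 < c := div_pos (sub_pos.2 hψ) hx₁
  have hcx : c * x₁ = ψ x₁ - ψ 0 := div_mul_cancel₀ _ hx₁.ne'
  have hpos : ∀ y, 0 ≤ y → ψ 0 + c * y - c * x₁ ≤ ψ y := by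
    intro y hy
    rcases le_total y x₁ with h | h
    · nlinarith [le_of_convexOn_of_even hc he y]
    · have hy0 : 0 < y := hx₁.trans_le h
      have := hc.2 (mem_univ y) (mem_univ 0) (show 0 ≤ x₁ / y by positivity)
        (sub_nonneg.2 ((div_le_one hy0).2 h)) (by ring)
      simp only [smul_eq_mul, mul_zero, add_zero, div_mul_cancel₀ _ hy0.ne'] at this
      have h3 : c * x₁ ≤ x₁ / y * (ψ y - ψ 0) := by rw [hcx]; linarith
      have h4 : c * y ≤ ψ y - ψ 0 := by
        have h5 : x₁ * (c * y) ≤ x₁ * (ψ y - ψ 0) := by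
          have h6 : x₁ / y * (ψ y - ψ 0) * y = x₁ * (ψ y - ψ 0) := by field_simp
          linarith [mul_le_mul_of_nonneg_right h3 hy0.le]
        exact le_of_mul_le_mul_left h5 hx₁
      nlinarith
  have habs : ∀ y, ψ 0 + c * |y| - c * x₁ ≤ ψ y := by
    intro y
    have h1 := hpos |y| (abs_nonneg y)
    rcases abs_choice y with h | h <;> rw [h] at h1 ⊢
    · exact h1
    · rwa [he] at h1
  refine ((integrable_exp_neg_mul_abs hc0).const_mul (Real.exp (c * x₁ - ψ 0))).mono'
    (continuous_of_convexOn hc).neg.rexp.aestronglyMeasurable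
    (Eventually.of_forall fun x => ?_)
  rw [Real.norm_of_nonneg (Real.exp_pos _).le, ← Real.exp_add]
  exact Real.exp_le_exp.2 (by linarith [habs x])

/-- The unnormalized tail `∫ z > x, exp (-ψ z)` of `nuPsi ψ`. -/
noncomputable def tail (ψ : ℝ → ℝ) (x : ℝ) : ℝ := ∫ z in Ioi x, Real.exp (-ψ z)

lemma tail_pos (hi : Integrable fun x => Real.exp (-ψ x)) (x : ℝ) : 0 < tail ψ x := by
  rw [tail, setIntegral_pos_iff_support_of_nonneg_ae
    (Eventually.of_forall fun _ => (Real.exp_pos _).le) hi.integrableOn]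
  have : Function.support (fun z => Real.exp (-ψ z)) = univ := by
    ext z; simp [(Real.exp_pos _).ne']
  rw [this, univ_inter, Real.volume_Ioi]
  exact ENNReal.zero_lt_top

lemma tail_add (ψ : ℝ → ℝ) (x d : ℝ) :
    tail ψ (x + d) = ∫ z in Ioi x, Real.exp (-ψ (z + d)) := by
  have := (measurePreserving_add_right (volume : Measure ℝ) d).setIntegral_preimage_emb
    (measurableEmbedding_addRight d) (fun z => Real.exp (-ψ z)) (Ioi (x + d))
  rw [tail, ← this]
  simp

lemma tail_add_le (hc : ConvexOn ℝ univ ψ) (hi : Integrable fun x => Real.exp (-ψ x))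
    {x d : ℝ} (hx : 0 ≤ x) (hd : 0 ≤ d) :
    tail ψ (x + d) ≤ Real.exp (-(ψ d - ψ 0)) * tail ψ x := by
  rw [tail_add, tail, ← integral_const_mul]
  refine setIntegral_mono_on (hi.comp_add_right d).integrableOn
    (hi.integrableOn.const_mul _) measurableSet_Ioi fun z hz => ?_
  rw [← Real.exp_add]
  exact Real.exp_le_exp.2 (by linarith [add_le_of_convexOn hc (hx.trans (mem_Ioi.1 hz).le) hd])

lemma tail_antitone (hi : Integrable fun x => Real.exp (-ψ x)) : Antitone (tail ψ) :=
  fun _ _ hxy => setIntegral_mono_set hi.integrableOn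
    (Eventually.of_forall fun _ => (Real.exp_pos _).le) (Ioi_subset_Ioi hxy).eventuallyLE

lemma hasDerivAt_tail (hψ : Continuous ψ) (hi : Integrable fun x => Real.exp (-ψ x)) (x : ℝ) :
    HasDerivAt (tail ψ) (-Real.exp (-ψ x)) x := by
  have h1 : tail ψ = fun y => tail ψ 0 - ∫ z in (0 : ℝ)..y, Real.exp (-ψ z) := by
    funext y
    rw [← intervalIntegral.integral_Ioi_sub_Ioi' hi.integrableOn hi.integrableOn]
    simp [tail]
  rw [h1]
  exact (hψ.neg.rexp.integral_hasStrictDerivAt 0 x).hasDerivAt.const_sub _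

/-- The inverse hazard rate of `nuPsi ψ` at the origin. -/
noncomputable def hazardInv (ψ : ℝ → ℝ) : ℝ := Real.exp (ψ 0) * tail ψ 0

lemma hazardInv_pos (hi : Integrable fun x => Real.exp (-ψ x)) : 0 < hazardInv ψ :=
  mul_pos (Real.exp_pos _) (tail_pos hi 0)

lemma tail_le_hazardInv_mul (hc : ConvexOn ℝ univ ψ) (hi : Integrable fun x => Real.exp (-ψ x))
    {x : ℝ} (hx : 0 ≤ x) : tail ψ x ≤ hazardInv ψ * Real.exp (-ψ x) := by
  have := tail_add_le hc hi le_rfl hx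
  rw [zero_add] at this
  refine this.trans (le_of_eq ?_)
  rw [hazardInv, show -(ψ x - ψ 0) = ψ 0 + -ψ x by ring, Real.exp_add]
  ring

/-- By log-concavity the hazard rate is at least its value at the origin on `[0, ∞)`. -/
lemma tail_le_exp_mul (hc : ConvexOn ℝ univ ψ) (hi : Integrable fun x => Real.exp (-ψ x))
    {x y : ℝ} (hx : 0 ≤ x) (hxy : x ≤ y) :
    tail ψ y ≤ Real.exp (-((y - x) / hazardInv ψ)) * tail ψ x := by
  have hL := hazardInv_pos hi
  have hder : ∀ z, HasDerivAt (fun z => tail ψ z * Real.exp (z / hazardInv ψ))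
      (-Real.exp (-ψ z) * Real.exp (z / hazardInv ψ) +
        tail ψ z * (Real.exp (z / hazardInv ψ) * (1 / hazardInv ψ))) z := fun z =>
    (hasDerivAt_tail (continuous_of_convexOn hc) hi z).mul
      (((hasDerivAt_id z).div_const _).exp)
  have hanti : AntitoneOn (fun z => tail ψ z * Real.exp (z / hazardInv ψ)) (Ici 0) := by
    refine antitoneOn_of_deriv_nonpos (convex_Ici 0)
      (fun z _ => (hder z).continuousAt.continuousWithinAt)
      (fun z _ => (hder z).differentiableAt.differentiableWithinAt) fun z hz => ?_
    rw [interior_Ici] at hz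
    rw [(hder z).deriv]
    have h1 : tail ψ z * (1 / hazardInv ψ) ≤ Real.exp (-ψ z) := by
      rw [mul_one_div, div_le_iff₀ hL, mul_comm]
      exact tail_le_hazardInv_mul hc hi (mem_Ioi.1 hz).le
    nlinarith [Real.exp_pos (z / hazardInv ψ)]
  have h := hanti hx (hx.trans hxy) hxy
  dsimp only at h
  rw [show -((y - x) / hazardInv ψ) = x / hazardInv ψ + -(y / hazardInv ψ) by ring,
    Real.exp_add, Real.exp_neg]
  rw [← le_div_iff₀ (Real.exp_pos _)] at h
  refine h.trans (le_of_eq ?_)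
  rw [div_eq_mul_inv]; ring

/-- The function `u ↦ F⁻¹ (G u)`, where `F` and `G` are the distribution functions of `nuOne` and
`nuPsi ψ`. -/
noncomputable def toExp (ψ : ℝ → ℝ) (x : ℝ) : ℝ :=
  if 0 ≤ x then Real.log (tail ψ 0 / tail ψ x) else -Real.log (tail ψ 0 / tail ψ (-x))

lemma toExp_of_nonneg {x : ℝ} (hx : 0 ≤ x) : toExp ψ x = Real.log (tail ψ 0 / tail ψ x) :=
  if_pos hx

lemma toExp_zero (hi : Integrable fun x => Real.exp (-ψ x)) : toExp ψ 0 = 0 := by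
  rw [toExp_of_nonneg le_rfl, div_self (tail_pos hi 0).ne', Real.log_one]

lemma toExp_neg (hi : Integrable fun x => Real.exp (-ψ x)) (x : ℝ) :
    toExp ψ (-x) = -toExp ψ x := by
  rcases lt_trichotomy x 0 with h | rfl | h
  · rw [toExp_of_nonneg (by linarith), toExp, if_neg (not_le.2 h), neg_neg]
  · rw [neg_zero, toExp_zero hi, neg_zero]
  · rw [toExp, if_neg (by linarith), neg_neg, toExp_of_nonneg h.le]

lemma le_toExp_sub_of_tail_le (hi : Integrable fun x => Real.exp (-ψ x)) {x y c : ℝ}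
    (hx : 0 ≤ x) (hxy : x ≤ y) (h : tail ψ y ≤ Real.exp (-c) * tail ψ x) :
    c ≤ toExp ψ y - toExp ψ x := by
  have hR := tail_pos hi
  rw [toExp_of_nonneg hx, toExp_of_nonneg (hx.trans hxy), Real.log_div (hR 0).ne' (hR y).ne',
    Real.log_div (hR 0).ne' (hR x).ne']
  have := Real.log_le_log (hR y) h
  rw [Real.log_mul (Real.exp_pos _).ne' (hR x).ne', Real.log_exp] at this
  linarith

/-- The growth of `toExp`: linear at all scales, and of the order of `ψ` at large scales. -/
lemma toExp_sub_ge (hc : ConvexOn ℝ univ ψ) (he : ∀ x, ψ (-x) = ψ x)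
    (hi : Integrable fun x => Real.exp (-ψ x)) {x y : ℝ} (hxy : x ≤ y) :
    (y - x) / hazardInv ψ ≤ toExp ψ y - toExp ψ x ∧
      ψ ((y - x) / 2) - ψ 0 ≤ toExp ψ y - toExp ψ x := by
  have hpos : ∀ x y : ℝ, 0 ≤ x → x ≤ y → (y - x) / hazardInv ψ ≤ toExp ψ y - toExp ψ x ∧
      ψ (y - x) - ψ 0 ≤ toExp ψ y - toExp ψ x := fun x y hx hxy =>
    ⟨le_toExp_sub_of_tail_le hi hx hxy (tail_le_exp_mul hc hi hx hxy),
      le_toExp_sub_of_tail_le hi hx hxy (by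
        have := tail_add_le hc hi hx (sub_nonneg.2 hxy)
        rwa [add_sub_cancel] at this)⟩
  have hhalf : ∀ d : ℝ, 0 ≤ d → ψ (d / 2) ≤ ψ d := fun d hd =>
    mono_of_convexOn_of_even hc he (by linarith) (by linarith)
  rcases le_total 0 x with hx | hx
  · exact ⟨(hpos x y hx hxy).1,
      (sub_le_sub_right (hhalf _ (sub_nonneg.2 hxy)) _).trans (hpos x y hx hxy).2⟩
  rcases le_total y 0 with hy | hy
  · have h := hpos (-y) (-x) (by linarith) (by linarith)
    rw [toExp_neg hi, toExp_neg hi, show -x - -y = y - x by ring,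
      show -toExp ψ x - -toExp ψ y = toExp ψ y - toExp ψ x by ring] at h
    exact ⟨h.1, (sub_le_sub_right (hhalf _ (sub_nonneg.2 hxy)) _).trans h.2⟩
  · have h1 := hpos 0 y le_rfl hy
    have h2 := hpos 0 (-x) le_rfl (by linarith)
    rw [toExp_zero hi, sub_zero, sub_zero] at h1 h2
    rw [toExp_neg hi] at h2
    have h3 := le_of_convexOn_of_even hc he
    refine ⟨?_, ?_⟩
    · have : (y - x) / hazardInv ψ = y / hazardInv ψ + -x / hazardInv ψ := by ring
      linarith [h1.1, h2.1]
    · rcases le_total (-x) y with h | h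
      · have := mono_of_convexOn_of_even hc he (x := (y - x) / 2) (y := y) (by linarith)
          (by linarith)
        linarith [h1.2, h2.2, h3 (-x)]
      · have := mono_of_convexOn_of_even hc he (x := (y - x) / 2) (y := -x) (by linarith)
          (by linarith)
        linarith [h1.2, h2.2, h3 y]

lemma toExp_strictMono (hc : ConvexOn ℝ univ ψ) (he : ∀ x, ψ (-x) = ψ x)
    (hi : Integrable fun x => Real.exp (-ψ x)) : StrictMono (toExp ψ) := by
  intro x y hxy
  have := (toExp_sub_ge hc he hi hxy.le).1
  have h2 := div_pos (sub_pos.2 hxy) (hazardInv_pos hi)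
  linarith

lemma toExp_surjective (hc : ConvexOn ℝ univ ψ) (he : ∀ x, ψ (-x) = ψ x)
    (hi : Integrable fun x => Real.exp (-ψ x)) : Function.Surjective (toExp ψ) := by
  have hpos : ∀ s : ℝ, 0 ≤ s → ∃ x, toExp ψ x = s := by
    intro s hs
    have hL := hazardInv_pos hi
    have hb : (0 : ℝ) ≤ hazardInv ψ * s := by positivity
    have hcont : ContinuousOn (toExp ψ) (Icc 0 (hazardInv ψ * s)) := by
      have h1 : ContinuousOn (fun x => Real.log (tail ψ 0 / tail ψ x))
          (Icc 0 (hazardInv ψ * s)) := fun x _ =>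
        ((continuousAt_const.div (hasDerivAt_tail (continuous_of_convexOn hc) hi x).continuousAt
          (tail_pos hi x).ne').log (div_pos (tail_pos hi 0) (tail_pos hi x)).ne').continuousWithinAt
      exact h1.congr fun x hx => toExp_of_nonneg hx.1
    have h2 := (toExp_sub_ge hc he hi hb).1
    rw [toExp_zero hi, sub_zero, sub_zero, mul_div_cancel_left₀ _ hL.ne'] at h2
    obtain ⟨x, -, hx⟩ := intermediate_value_Icc hb hcont
      (show s ∈ Icc _ _ from ⟨by rwa [toExp_zero hi], h2⟩)
    exact ⟨x, hx⟩
  intro s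
  rcases le_total 0 s with h | h
  · exact hpos s h
  · obtain ⟨x, hx⟩ := hpos (-s) (by linarith)
    exact ⟨-x, by rw [toExp_neg hi, hx, neg_neg]⟩

lemma integral_exp_neg_eq_two_mul_tail (he : ∀ x, ψ (-x) = ψ x)
    (hi : Integrable fun x => Real.exp (-ψ x)) :
    ∫ z, Real.exp (-ψ z) = 2 * tail ψ 0 := by
  rw [← intervalIntegral.integral_Iic_add_Ioi (b := 0) hi.integrableOn hi.integrableOn,
    ← neg_zero, ← integral_comp_neg_Ioi]
  simp only [he, neg_zero, tail]
  ring

lemma nuPsi_Iic (he : ∀ x, ψ (-x) = ψ x) (hi : Integrable fun x => Real.exp (-ψ x)) (x : ℝ) :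
    nuPsi ψ (Iic x) = ENNReal.ofReal (expCdf (toExp ψ x)) := by
  have hR := tail_pos hi
  rw [nuPsi, withDensity_apply _ measurableSet_Iic, ← ofReal_integral_eq_lintegral_ofReal
    (hi.integrableOn.const_mul _) (Eventually.of_forall fun z =>
      mul_nonneg (inv_nonneg.2 (integral_nonneg fun _ => (Real.exp_pos _).le))
        (Real.exp_pos _).le), integral_const_mul, integral_exp_neg_eq_two_mul_tail he hi]
  congr 1
  have hlog : ∀ y, 0 ≤ y → Real.exp (-toExp ψ y) = tail ψ y / tail ψ 0 ∧ 0 ≤ toExp ψ y := by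
    intro y hy
    rw [toExp_of_nonneg hy, ← Real.log_inv, inv_div,
      Real.exp_log (div_pos (hR y) (hR 0))]
    exact ⟨rfl, Real.log_nonneg ((one_le_div (hR y)).2 (tail_antitone hi hy))⟩
  rcases le_total 0 x with hx | hx
  · obtain ⟨h1, h2⟩ := hlog x hx
    rw [expCdf_of_nonneg h2, h1]
    have h3 := intervalIntegral.integral_Iic_add_Ioi (b := x) hi.integrableOn hi.integrableOn
    rw [integral_exp_neg_eq_two_mul_tail he hi, ← tail] at h3
    rw [← eq_sub_iff_add_eq] at h3
    rw [h3]
    have := (hR 0).ne'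
    field_simp
  · obtain ⟨h1, h2⟩ := hlog (-x) (by linarith)
    rw [toExp_neg hi] at h1 h2
    rw [neg_neg] at h1
    rw [expCdf_of_nonpos (by linarith), h1]
    have h3 := integral_comp_neg_Ioi (-x) fun z => Real.exp (-ψ z)
    simp only [he, neg_neg] at h3
    rw [← h3, ← tail]
    have := (hR 0).ne'
    field_simp

/-- The increasing rearrangement, inverse to `toExp`, carries `nuOne` to `nuPsi ψ`. -/
lemma exists_map_nuOne_eq_nuPsi (hc : ConvexOn ℝ univ ψ) (he : ∀ x, ψ (-x) = ψ x)
    (hi : Integrable fun x => Real.exp (-ψ x)) :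
    ∃ T : ℝ → ℝ, Monotone T ∧ (∀ x, toExp ψ (T x) = x) ∧ nuOne.map T = nuPsi ψ := by
  choose T hT using toExp_surjective hc he hi
  have hmono := toExp_strictMono hc he hi
  have hiff : ∀ x v, T x ≤ v ↔ x ≤ toExp ψ v := fun x v => by
    rw [← hmono.le_iff_le, hT]
  have hTm : Monotone T := fun x y hxy => (hiff x _).2 (by rwa [hT])
  refine ⟨T, hTm, hT, ?_⟩
  have : IsProbabilityMeasure (nuOne.map T) :=
    Measure.isProbabilityMeasure_map hTm.measurable.aemeasurable
  refine Measure.ext_of_Iic _ _ fun v => ?_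
  rw [Measure.map_apply hTm.measurable measurableSet_Iic, nuPsi_Iic he hi, ← nuOne_Iic]
  congr 1
  ext x
  exact hiff x v

lemma isPenalty_hPsi (hc : ConvexOn ℝ univ ψ) (h0 : ∀ x, 0 ≤ ψ x) {C : ℝ} (hC : 0 < C) :
    IsPenalty (hPsi ψ C) where
  measurable := by
    have hψ := (continuous_of_convexOn hc).measurable
    unfold hPsi
    exact Measurable.ite (measurableSet_le (by fun_prop) measurable_const) (by fun_prop)
      (by fun_prop)
  nonneg x y := by
    unfold hPsi
    split_ifs
    · positivity
    · exact mul_nonneg (by positivity) (h0 _)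
  diag x := by simp [hPsi]

/-- The rearrangement is Lipschitz with constant `hazardInv ψ`, and its large increments `d` need
increments of the argument of the order of `ψ (d / 2)`. -/
lemma exists_concentrates_nuPsi (hc : ConvexOn ℝ univ ψ) (he : ∀ x, ψ (-x) = ψ x)
    (h0 : ∀ x, 0 ≤ ψ x) (hi : Integrable fun x => Real.exp (-ψ x)) :
    ∃ C : ℝ, 0 < C ∧ Concentrates (nuPsi ψ) (hPsi ψ C) := by
  obtain ⟨T, hTm, hT, hmap⟩ := exists_map_nuOne_eq_nuPsi hc he hi
  set L := hazardInv ψ with hLdef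
  have hL : 0 < L := hazardInv_pos hi
  have hψ0 := h0 0
  have hp1 : 0 ≤ ψ 0 * L := by positivity
  have hp2 : 0 ≤ ψ 0 * L * L := by positivity
  have hC : 0 < 2 + L + L ^ 2 + (1 + ψ 0 * L) * (1 + L) := by positivity
  refine ⟨2 + L + L ^ 2 + (1 + ψ 0 * L) * (1 + L), hC, ?_⟩
  set C := 2 + L + L ^ 2 + (1 + ψ 0 * L) * (1 + L) with hCdef
  rw [← hmap]
  refine concentrates_nuOne_hOne.map hTm.measurable (isPenalty_hPsi hc h0 hC).nonneg fun x y => ?_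
  have hgrow : |T x - T y| / L ≤ |x - y| ∧ ψ (|T x - T y| / 2) - ψ 0 ≤ |x - y| := by
    rcases le_total x y with h | h
    · rw [abs_sub_comm, abs_of_nonneg (sub_nonneg.2 (hTm h)), abs_sub_comm,
        abs_of_nonneg (sub_nonneg.2 h)]
      simpa only [hT] using toExp_sub_ge hc he hi (hTm h)
    · rw [abs_of_nonneg (sub_nonneg.2 (hTm h)), abs_of_nonneg (sub_nonneg.2 h)]
      simpa only [hT] using toExp_sub_ge hc he hi (hTm h)
  unfold hPsi hOne
  have hd0 : 0 ≤ |T x - T y| := abs_nonneg _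
  have hs0 : 0 ≤ |x - y| := abs_nonneg _
  generalize |T x - T y| = d at hgrow hd0 ⊢
  generalize |x - y| = s at hgrow hs0 ⊢
  obtain ⟨hds, hψs⟩ := hgrow
  rw [div_le_iff₀ hL] at hds
  rw [le_min_iff]
  split_ifs with hd1
  · rw [one_div_mul_eq_div, div_le_iff₀ hC, div_le_iff₀ hC]
    have h1 : d ^ 2 ≤ d := by nlinarith
    have h2 : d ^ 2 ≤ (s * L) ^ 2 := pow_le_pow_left₀ hd0 hds 2
    have h3 : L ≤ C := by rw [hCdef]; nlinarith
    have h4 : L ^ 2 ≤ C := by rw [hCdef]; nlinarith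
    constructor
    · nlinarith [mul_le_mul_of_nonneg_left h3 hs0]
    · nlinarith [mul_le_mul_of_nonneg_left h4 (sq_nonneg s)]
  · rw [not_le] at hd1
    have hsL : 1 ≤ s * L := by linarith
    have hC2 : 2 ≤ C := by rw [hCdef]; nlinarith
    have h1 : ψ (1 / C * d) ≤ ψ (d / 2) := by
      refine mono_of_convexOn_of_even hc he (by positivity) ?_
      rw [one_div_mul_eq_div]
      exact div_le_div_of_nonneg_left hd0 two_pos hC2
    have h2 : ψ (1 / C * d) ≤ (1 + ψ 0 * L) * s := by nlinarith
    rw [one_div_mul_eq_div C (ψ _), div_le_iff₀ hC, div_le_iff₀ hC]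
    have h3 : (1 + ψ 0 * L) * (1 + L) ≤ C := by rw [hCdef]; nlinarith
    have h4 : 1 + ψ 0 * L ≤ C := by nlinarith
    refine ⟨h2.trans (by nlinarith), h2.trans ?_⟩
    calc (1 + ψ 0 * L) * s ≤ (1 + ψ 0 * L) * s * (s * L) :=
          le_mul_of_one_le_right (by positivity) hsL
      _ = s ^ 2 * ((1 + ψ 0 * L) * L) := by ring
      _ ≤ s ^ 2 * C := mul_le_mul_of_nonneg_left (by nlinarith) (sq_nonneg s)

end LogConcave

end Penalty

/-! ### The infimum-convolution inequality for slowly increasing functions on the line -/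

namespace Penalty

/-- The infimum-convolution `x ↦ inf {ψ (x - s) + l / 2 * s² : 0 ≤ s ≤ 1}`; only displacements to
the left are needed for increasing functions. -/
noncomputable def infConv (l : ℝ) (ψ : ℝ → ℝ) (x : ℝ) : ℝ :=
  ⨅ s : Icc (0 : ℝ) 1, (ψ (x - s) + l / 2 * (s : ℝ) ^ 2)

section

variable {l : ℝ} {ψ : ℝ → ℝ}

lemma bddBelow_infConv (hl : 0 ≤ l) (hm : Monotone ψ) (x : ℝ) :
    BddBelow (range fun s : Icc (0 : ℝ) 1 => ψ (x - s) + l / 2 * (s : ℝ) ^ 2) := by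
  refine ⟨ψ (x - 1), ?_⟩
  rintro _ ⟨s, rfl⟩
  have h1 : ψ (x - 1) ≤ ψ (x - s) := hm (by linarith [s.2.2])
  have h2 : 0 ≤ l / 2 * (s : ℝ) ^ 2 := by positivity
  exact h1.trans (le_add_of_nonneg_right h2)

lemma infConv_le (hl : 0 ≤ l) (hm : Monotone ψ) (x : ℝ) {s : ℝ} (h0 : 0 ≤ s) (h1 : s ≤ 1) :
    infConv l ψ x ≤ ψ (x - s) + l / 2 * s ^ 2 :=
  ciInf_le (bddBelow_infConv hl hm x) ⟨s, h0, h1⟩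

lemma infConv_le_self (hl : 0 ≤ l) (hm : Monotone ψ) (x : ℝ) : infConv l ψ x ≤ ψ x := by
  simpa using infConv_le hl hm x le_rfl zero_le_one

lemma le_infConv (hl : 0 ≤ l) (hlip : ∀ x y, x ≤ y → ψ y ≤ ψ x + l * (y - x)) (x : ℝ) :
    ψ x - l ≤ infConv l ψ x := by
  refine le_ciInf fun s => ?_
  have h1 := hlip (x - s) x (by linarith [s.2.1])
  have h2 : 0 ≤ l / 2 * (s : ℝ) ^ 2 := by positivity
  nlinarith [s.2.2]

lemma infConv_mono (hl : 0 ≤ l) (hm : Monotone ψ) : Monotone (infConv l ψ) := fun x y hxy =>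
  ciInf_mono (bddBelow_infConv hl hm x) fun s => by
    have := hm (sub_le_sub_right hxy (s : ℝ))
    linarith

lemma continuous_of_monotone_of_lip (hl : 0 ≤ l) (hm : Monotone ψ)
    (hlip : ∀ x y, x ≤ y → ψ y ≤ ψ x + l * (y - x)) : Continuous ψ := by
  refine (LipschitzWith.of_dist_le_mul (K := l.toNNReal) fun x y => ?_).continuous
  rw [Real.dist_eq, Real.dist_eq, Real.coe_toNNReal l hl]
  rcases le_total x y with h | h
  · rw [abs_sub_comm, abs_of_nonneg (sub_nonneg.2 (hm h)), abs_sub_comm,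
      abs_of_nonneg (sub_nonneg.2 h)]
    linarith [hlip x y h]
  · rw [abs_of_nonneg (sub_nonneg.2 (hm h)), abs_of_nonneg (sub_nonneg.2 h)]
    linarith [hlip y x h]

/-- On a unit interval the infimum-convolution gains on average at least a multiple of the square
of the increment of `ψ`. All displacements are taken equal there, which makes the gain telescope. -/
lemma sq_increment_le_integral (hl : 0 < l) (hm : Monotone ψ)
    (hlip : ∀ x y, x ≤ y → ψ y ≤ ψ x + l * (y - x)) (a : ℝ) :
    (ψ (a + 1) - ψ a) ^ 2 / (8 * l) ≤ ∫ x in a..(a + 1), (ψ x - infConv l ψ x) := by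
  have hcont := continuous_of_monotone_of_lip hl.le hm hlip
  have hint : ∀ c d, IntervalIntegrable ψ volume c d := fun c d => hcont.intervalIntegrable c d
  set D := ψ (a + 1) - ψ a with hD
  have hD0 : 0 ≤ D := sub_nonneg.2 (hm (by linarith))
  have hDl : D ≤ l := by have := hlip a (a + 1) (by linarith); linarith
  -- the displacement at which `D * σ - l * σ² - l / 2 * σ²` is of order `D ^ 2`
  set σ := D / (2 * l) with hσ
  have hσD : D = 2 * l * σ := by rw [hσ]; field_simp
  have hσ0 : 0 ≤ σ := by positivity
  have hσ1 : σ ≤ 1 := by rw [hσ, div_le_one (by positivity)]; linarith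
  have h1 : ∫ x in a..(a + 1), (ψ x - (ψ (x - σ) + l / 2 * σ ^ 2)) ≤
      ∫ x in a..(a + 1), (ψ x - infConv l ψ x) := by
    refine intervalIntegral.integral_mono_on (by linarith) ?_ ?_ fun x _ => ?_
    · exact Continuous.intervalIntegrable (by fun_prop) _ _
    · exact (hint _ _).sub (infConv_mono hl.le hm).intervalIntegrable
    · linarith [infConv_le hl.le hm x hσ0 hσ1]
  refine le_trans ?_ h1
  have h2 : ∫ x in a..(a + 1), (ψ x - (ψ (x - σ) + l / 2 * σ ^ 2)) =
      (∫ x in (a + 1 - σ)..(a + 1), ψ x) - (∫ x in (a - σ)..a, ψ x) - l / 2 * σ ^ 2 := by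
    rw [intervalIntegral.integral_sub (hint _ _)
      (Continuous.intervalIntegrable (by fun_prop) _ _), intervalIntegral.integral_add
      (Continuous.intervalIntegrable (by fun_prop) _ _) (by simp),
      intervalIntegral.integral_comp_sub_right, intervalIntegral.integral_const,
      ← intervalIntegral.integral_add_adjacent_intervals (hint (a + 1 - σ) a) (hint a (a + 1)),
      ← intervalIntegral.integral_add_adjacent_intervals (hint (a - σ) a) (hint a (a + 1 - σ)),
      intervalIntegral.integral_symm a (a + 1 - σ), smul_eq_mul]
    ring
  have h3 : σ * ψ (a + 1 - σ) ≤ ∫ x in (a + 1 - σ)..(a + 1), ψ x := by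
    have := intervalIntegral.integral_mono_on (a := a + 1 - σ) (b := a + 1) (by linarith)
      (f := fun _ => ψ (a + 1 - σ)) (by simp) (hint _ _) fun x hx => hm hx.1
    rw [intervalIntegral.integral_const, smul_eq_mul] at this
    linarith
  have h4 : ∫ x in (a - σ)..a, ψ x ≤ σ * ψ a := by
    have := intervalIntegral.integral_mono_on (a := a - σ) (b := a) (by linarith)
      (g := fun _ => ψ a) (hint _ _) (by simp) fun x hx => hm hx.2
    rw [intervalIntegral.integral_const, smul_eq_mul] at this
    linarith
  have h5 : D - l * σ ≤ ψ (a + 1 - σ) - ψ a := by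
    have := hlip (a + 1 - σ) (a + 1) (by linarith)
    linarith
  have h6 : σ * (D - l * σ) ≤ σ * (ψ (a + 1 - σ) - ψ a) := mul_le_mul_of_nonneg_left h5 hσ0
  have h7 : D ^ 2 / (8 * l) = σ * (D - l * σ) - l / 2 * σ ^ 2 := by
    rw [hσD]; field_simp; ring
  rw [h2, h7]
  linarith

/-- The local comparison: with `δ` the gain, `e ^ (y - δ) + e ^ (-y)` against its value `2` at
`y = 0`, `δ = 0`. -/
lemma exp_add_exp_neg_le {w y S : ℝ} (hwy : w ≤ y) (hyw : y - 1 ≤ w) (hS : |y| ≤ S) :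
    Real.exp w + Real.exp (-y) - 2 ≤
      (2 * Real.cosh S - 2) - Real.exp (-S) * ((y - w) / 2) := by
  have h1 : Real.cosh y ≤ Real.cosh S := Real.cosh_le_cosh.2 (hS.trans (le_abs_self S))
  rw [Real.cosh_eq y] at h1
  have h2 : Real.exp (w - y) ≤ 1 - (y - w) / 2 := by
    have h3 := Real.add_one_le_exp (y - w)
    have h4 : Real.exp (w - y) * Real.exp (y - w) = 1 := by rw [← Real.exp_add]; simp
    have h5 := Real.exp_pos (w - y)
    have h6 : Real.exp (w - y) * (y - w + 1) ≤ 1 := by nlinarith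
    nlinarith
  have h7 : Real.exp w = Real.exp y * Real.exp (w - y) := by rw [← Real.exp_add]; congr 1; ring
  have h8 : Real.exp (-S) ≤ Real.exp y := Real.exp_le_exp.2 (by linarith [(abs_le.1 hS).1])
  have h9 : Real.exp y * Real.exp (w - y) ≤ Real.exp y * (1 - (y - w) / 2) :=
    mul_le_mul_of_nonneg_left h2 (Real.exp_pos y).le
  have h10 : Real.exp (-S) * ((y - w) / 2) ≤ Real.exp y * ((y - w) / 2) :=
    mul_le_mul_of_nonneg_right h8 (by linarith)
  rw [h7]
  linarith

/-- The growth of `2 cosh - 2` along a small step. Since the factor `2` is less than `e`, this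
growth is absorbed by the decay of the exponential law over a unit interval. -/
lemma cosh_add_le {S D : ℝ} (hD : 0 ≤ D) (hD1 : D ≤ 1 / 1000) :
    2 * Real.cosh (S + D) - 2 ≤
      2 * (2 * Real.cosh S - 2) + 4 * (Real.exp (-(S + D)) * D ^ 2) := by
  -- with `p = e ^ (S / 2)` and `d = e ^ (D / 2)`, `2 cosh S - 2` is `(p - p⁻¹)²`
  set p := Real.exp (S / 2) with hp
  set p' := Real.exp (-(S / 2)) with hp'
  set d := Real.exp (D / 2) with hd
  set d' := Real.exp (-(D / 2)) with hd'
  have hpp : p * p' = 1 := by rw [hp, hp', ← Real.exp_add]; simp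
  have hdd : d * d' = 1 := by rw [hd, hd', ← Real.exp_add]; simp
  have e1 : Real.exp S = p ^ 2 := by rw [hp, sq, ← Real.exp_add]; congr 1; ring
  have e2 : Real.exp (-S) = p' ^ 2 := by rw [hp', sq, ← Real.exp_add]; congr 1; ring
  have e3 : Real.exp D = d ^ 2 := by rw [hd, sq, ← Real.exp_add]; congr 1; ring
  have e4 : Real.exp (-D) = d' ^ 2 := by rw [hd', sq, ← Real.exp_add]; congr 1; ring
  have q1 : 2 * Real.cosh S - 2 = (p - p') ^ 2 := by
    rw [Real.cosh_eq, e1, e2]; linear_combination 2 * hpp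
  have q2 : 2 * Real.cosh (S + D) - 2 = ((p - p') * d + p' * (d - d')) ^ 2 := by
    rw [Real.cosh_eq, neg_add, Real.exp_add, Real.exp_add, e1, e2, e3, e4]
    linear_combination 2 * p * p' * hdd + 2 * hpp
  have hd1 : 1 ≤ d := Real.one_le_exp (by linarith)
  have hd'1 : 1 - D / 2 ≤ d' := by have := Real.add_one_le_exp (-(D / 2)); linarith
  have hd'p : 0 < d' := Real.exp_pos _
  have hd2 : d ≤ 1 + 51 / 100 * D := by nlinarith
  have hdsub : d - d' ≤ 101 / 100 * D := by linarith
  have hdsub0 : 0 ≤ d - d' := by nlinarith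
  have hsq : (d - d') ^ 2 ≤ (101 / 100 * D) ^ 2 := pow_le_pow_left₀ hdsub0 hdsub 2
  have hdsq : d ^ 2 ≤ 4 / 3 := by nlinarith
  have hd'sq : 99 / 100 ≤ d' ^ 2 := by nlinarith
  rw [q1, q2, neg_add, Real.exp_add, e2, e4]
  have h1 : ((p - p') * d + p' * (d - d')) ^ 2 ≤
      3 / 2 * ((p - p') ^ 2 * d ^ 2) + 3 * (p' ^ 2 * (d - d') ^ 2) := by
    nlinarith [sq_nonneg ((p - p') * d - 2 * (p' * (d - d')))]
  have h2 : (p - p') ^ 2 * d ^ 2 ≤ (p - p') ^ 2 * (4 / 3) :=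
    mul_le_mul_of_nonneg_left hdsq (sq_nonneg _)
  have h3 : p' ^ 2 * (d - d') ^ 2 ≤ p' ^ 2 * (101 / 100 * D) ^ 2 :=
    mul_le_mul_of_nonneg_left hsq (sq_nonneg _)
  have h4 : p' ^ 2 * D ^ 2 * (99 / 100) ≤ p' ^ 2 * D ^ 2 * d' ^ 2 :=
    mul_le_mul_of_nonneg_left hd'sq (by positivity)
  nlinarith [mul_nonneg (sq_nonneg p') (sq_nonneg D)]

lemma exp_neg_one_bounds : 0.36 ≤ Real.exp (-1) ∧ Real.exp (-1) ≤ 0.375 := by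
  have h1 := Real.exp_one_gt_d9
  have h2 := Real.exp_one_lt_d9
  have h3 : Real.exp (-1) * Real.exp 1 = 1 := by rw [← Real.exp_add]; simp
  have h4 := Real.exp_pos (-1)
  constructor <;> nlinarith

/-- The integrand `e ^ w + e ^ (-ψ)`, `w` the infimum-convolution of `ψ`. -/
noncomputable def expSum (l : ℝ) (ψ : ℝ → ℝ) (x : ℝ) : ℝ :=
  Real.exp (infConv l ψ x) + Real.exp (-ψ x)

lemma measurable_expSum (hl : 0 ≤ l) (hm : Monotone ψ) : Measurable (expSum l ψ) :=
  (infConv_mono hl hm).measurable.exp.add hm.measurable.neg.exp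

lemma intervalIntegrable_expSum_sub_mul (hl : 0 ≤ l) (hm : Monotone ψ) {ρ : ℝ → ℝ}
    (hρ : Continuous ρ) (c a b : ℝ) :
    IntervalIntegrable (fun x => (expSum l ψ x - c) * ρ x) volume a b := by
  have h1 : Monotone fun x => Real.exp (infConv l ψ x) :=
    Real.exp_monotone.comp (infConv_mono hl hm)
  have h2 : Antitone fun x => Real.exp (-ψ x) :=
    Real.exp_monotone.comp_antitone hm.neg
  exact ((h1.intervalIntegrable.add h2.intervalIntegrable).sub
    intervalIntegrable_const).mul_continuousOn hρ.continuousOn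

/-- One step of the telescoping estimate, over a unit interval on which `|ψ|` is at most `S + D`,
where `D` is the increment of `ψ`, and on which the weight is between `m / e` and `m`. -/
lemma integral_unit_le (hl : 0 < l) (hl1 : l ≤ 1 / 1000) (hm : Monotone ψ)
    (hlip : ∀ x y, x ≤ y → ψ y ≤ ψ x + l * (y - x)) {ρ : ℝ → ℝ} (hρ : Continuous ρ)
    {a m S : ℝ} (hm0 : 0 < m)
    (hS : ∀ x ∈ Icc a (a + 1), |ψ x| ≤ S + (ψ (a + 1) - ψ a))
    (hρ1 : ∀ x ∈ Icc a (a + 1), m * Real.exp (-1) ≤ ρ x)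
    (hρ2 : ∀ x ∈ Icc a (a + 1), ρ x ≤ m) :
    ∫ x in a..(a + 1), (expSum l ψ x - 2) * ρ x ≤
      m * (8 * (2 * Real.cosh S - 2)) -
        m * Real.exp (-1) * (8 * (2 * Real.cosh (S + (ψ (a + 1) - ψ a)) - 2)) := by
  have hD := sq_increment_le_integral hl hm hlip a
  have hcont := continuous_of_monotone_of_lip hl.le hm hlip
  have hD0 : 0 ≤ ψ (a + 1) - ψ a := sub_nonneg.2 (hm (by linarith))
  have hDl : ψ (a + 1) - ψ a ≤ l := by have := hlip a (a + 1) (by linarith); linarith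
  set D := ψ (a + 1) - ψ a
  have hgrow := cosh_add_le (S := S) hD0 (hDl.trans hl1)
  have hq : 0 ≤ 2 * Real.cosh (S + D) - 2 := by linarith [Real.one_le_cosh (S + D)]
  have hδint : IntervalIntegrable (fun x => ψ x - infConv l ψ x) volume a (a + 1) :=
    (hcont.intervalIntegrable _ _).sub (infConv_mono hl.le hm).intervalIntegrable
  have h1 : ∫ x in a..(a + 1), (expSum l ψ x - 2) * ρ x ≤
      ∫ x in a..(a + 1), (m * (2 * Real.cosh (S + D) - 2) -
        m * Real.exp (-1) * Real.exp (-(S + D)) / 2 * (ψ x - infConv l ψ x)) := by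
    refine intervalIntegral.integral_mono_on (by linarith)
      (intervalIntegrable_expSum_sub_mul hl.le hm hρ 2 _ _)
      (intervalIntegrable_const.sub (hδint.const_mul _)) fun x hx => ?_
    have hδ0 := infConv_le_self hl.le hm x
    have h2 := exp_add_exp_neg_le hδ0 (by linarith [le_infConv hl.le hlip x]) (hS x hx)
    have hρ0 : 0 ≤ ρ x := le_trans (by positivity) (hρ1 x hx)
    have h3 : (expSum l ψ x - 2) * ρ x ≤ ((2 * Real.cosh (S + D) - 2) -
        Real.exp (-(S + D)) * ((ψ x - infConv l ψ x) / 2)) * ρ x :=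
      mul_le_mul_of_nonneg_right h2 hρ0
    have h4 : (2 * Real.cosh (S + D) - 2) * ρ x ≤ (2 * Real.cosh (S + D) - 2) * m :=
      mul_le_mul_of_nonneg_left (hρ2 x hx) hq
    have h5 : Real.exp (-(S + D)) * ((ψ x - infConv l ψ x) / 2) * (m * Real.exp (-1)) ≤
        Real.exp (-(S + D)) * ((ψ x - infConv l ψ x) / 2) * ρ x :=
      mul_le_mul_of_nonneg_left (hρ1 x hx)
        (mul_nonneg (Real.exp_pos _).le (by linarith))
    linarith
  rw [intervalIntegral.integral_sub intervalIntegrable_const (hδint.const_mul _),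
    intervalIntegral.integral_const, intervalIntegral.integral_const_mul, add_sub_cancel_left,
    one_smul] at h1
  obtain ⟨he1, he2⟩ := exp_neg_one_bounds
  set e₁ := Real.exp (-1)
  set E := Real.exp (-(S + D))
  have hE : 0 < E := Real.exp_pos _
  have h6 : m * e₁ * E / 2 * (D ^ 2 / (8 * l)) ≤
      m * e₁ * E / 2 * ∫ x in a..(a + 1), (ψ x - infConv l ψ x) :=
    mul_le_mul_of_nonneg_left hD (by positivity)
  have h7 : 125 * D ^ 2 ≤ D ^ 2 / (8 * l) := by
    rw [le_div_iff₀ (by positivity)]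
    nlinarith [sq_nonneg D]
  have h8 : m * e₁ * E / 2 * (125 * D ^ 2) ≤ m * e₁ * E / 2 * (D ^ 2 / (8 * l)) :=
    mul_le_mul_of_nonneg_left h7 (by positivity)
  have h9 : 16 * (E * D ^ 2) ≤ e₁ / 2 * 125 * (E * D ^ 2) :=
    mul_le_mul_of_nonneg_right (by linarith) (by positivity)
  have h10 : (1 + 8 * e₁) * (2 * Real.cosh (S + D) - 2) ≤ 4 * (2 * Real.cosh (S + D) - 2) :=
    mul_le_mul_of_nonneg_right (by linarith) hq
  have h11 : (1 + 8 * e₁) * (2 * Real.cosh (S + D) - 2) ≤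
      8 * (2 * Real.cosh S - 2) + e₁ / 2 * 125 * (E * D ^ 2) := by linarith
  have h12 := mul_le_mul_of_nonneg_left h11 hm0.le
  linarith

lemma integral_pos_side_le (hl : 0 < l) (hl1 : l ≤ 1 / 1000) (hm : Monotone ψ)
    (hlip : ∀ x y, x ≤ y → ψ y ≤ ψ x + l * (y - x)) (h0 : ψ 0 = 0) (N : ℕ) :
    ∫ x in (0 : ℝ)..N, (expSum l ψ x - 2) * Real.exp (-|x|) ≤
      -(Real.exp (-N) * (8 * (2 * Real.cosh (ψ N) - 2))) := by
  induction N with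
  | zero => simp [h0]
  | succ N ih =>
    have hint := intervalIntegrable_expSum_sub_mul hl.le hm
      (ρ := fun x => Real.exp (-|x|)) (by fun_prop) 2
    have hN : (0 : ℝ) ≤ N := N.cast_nonneg
    have key := integral_unit_le hl hl1 hm hlip (ρ := fun x => Real.exp (-|x|)) (by fun_prop)
      (a := N) (m := Real.exp (-N)) (S := ψ N) (Real.exp_pos _)
      (fun x hx => by
        have h1 : 0 ≤ ψ x := h0 ▸ hm (hN.trans hx.1)
        rw [abs_of_nonneg h1, add_sub_cancel]
        exact hm hx.2)
      (fun x hx => by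
        rw [← Real.exp_add, abs_of_nonneg (hN.trans hx.1)]
        exact Real.exp_le_exp.2 (by linarith [hx.2]))
      (fun x hx => by
        rw [abs_of_nonneg (hN.trans hx.1)]
        exact Real.exp_le_exp.2 (by linarith [hx.1]))
    rw [add_sub_cancel, ← Real.exp_add] at key
    push_cast
    rw [← intervalIntegral.integral_add_adjacent_intervals (hint 0 N) (hint N (N + 1)),
      show -((N : ℝ) + 1) = -N + -1 by ring]
    linarith

lemma integral_neg_side_le (hl : 0 < l) (hl1 : l ≤ 1 / 1000) (hm : Monotone ψ)
    (hlip : ∀ x y, x ≤ y → ψ y ≤ ψ x + l * (y - x)) (h0 : ψ 0 = 0) (N : ℕ) :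
    ∫ x in (-N : ℝ)..0, (expSum l ψ x - 2) * Real.exp (-|x|) ≤
      -(Real.exp (-N) * (8 * (2 * Real.cosh (-ψ (-N)) - 2))) := by
  induction N with
  | zero => simp [h0]
  | succ N ih =>
    have hint := intervalIntegrable_expSum_sub_mul hl.le hm
      (ρ := fun x => Real.exp (-|x|)) (by fun_prop) 2
    have hN : (0 : ℝ) ≤ N := N.cast_nonneg
    have ha : -((N : ℝ) + 1) + 1 = -N := by ring
    have key := integral_unit_le hl hl1 hm hlip (ρ := fun x => Real.exp (-|x|)) (by fun_prop)
      (a := -((N : ℝ) + 1)) (m := Real.exp (-N)) (S := -ψ (-N)) (Real.exp_pos _)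
      (fun x hx => by
        rw [ha] at hx ⊢
        have h1 : ψ x ≤ 0 := h0 ▸ hm (by linarith [hx.2])
        rw [abs_of_nonpos h1]
        linarith [hm hx.1])
      (fun x hx => by
        rw [ha] at hx
        rw [← Real.exp_add, abs_of_nonpos (by linarith [hx.2])]
        exact Real.exp_le_exp.2 (by linarith [hx.1]))
      (fun x hx => by
        rw [ha] at hx
        rw [abs_of_nonpos (by linarith [hx.2])]
        exact Real.exp_le_exp.2 (by linarith [hx.2]))
    rw [ha, ← Real.exp_add, show -ψ (-N) + (ψ (-N) - ψ (-((N : ℝ) + 1))) =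
      -ψ (-((N : ℝ) + 1)) by ring] at key
    push_cast
    rw [← intervalIntegral.integral_add_adjacent_intervals (hint (-(N + 1)) (-N)) (hint (-N) 0),
      show Real.exp (-((N : ℝ) + 1)) = Real.exp (-N + -1) by congr 1; ring]
    linarith

lemma integral_exp_neg_abs_le (N : ℕ) : ∫ x in (-N : ℝ)..N, Real.exp (-|x|) ≤ 2 := by
  have hN : (0 : ℝ) ≤ N := N.cast_nonneg
  have hint : ∀ a b : ℝ, IntervalIntegrable (fun x => Real.exp (-|x|)) volume a b := fun a b =>
    Continuous.intervalIntegrable (by fun_prop) _ _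
  have h1 : ∫ x in (0 : ℝ)..N, Real.exp (-|x|) = 1 - Real.exp (-N) := by
    have : ∫ x in (0 : ℝ)..N, Real.exp (-|x|) = ∫ x in (0 : ℝ)..N, Real.exp (-x) :=
      intervalIntegral.integral_congr fun x hx => by
        rw [uIcc_of_le hN] at hx
        simp only [abs_of_nonneg hx.1]
    rw [this, intervalIntegral.integral_comp_neg fun x => Real.exp x, integral_exp]
    simp
  have h2 : ∫ x in (-N : ℝ)..0, Real.exp (-|x|) = 1 - Real.exp (-N) := by
    rw [← h1]
    have := intervalIntegral.integral_comp_neg (a := 0) (b := N) fun x : ℝ => Real.exp (-|x|)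
    simpa using this.symm
  rw [← intervalIntegral.integral_add_adjacent_intervals (hint (-N) 0) (hint 0 N), h1, h2]
  linarith [Real.exp_pos (-(N : ℝ))]

lemma lintegral_expSum_le (hl : 0 < l) (hl1 : l ≤ 1 / 1000) (hm : Monotone ψ)
    (hlip : ∀ x y, x ≤ y → ψ y ≤ ψ x + l * (y - x)) (h0 : ψ 0 = 0) :
    ∫⁻ x, ENNReal.ofReal (expSum l ψ x) ∂nuOne ≤ 2 := by
  have hcov : AECover nuOne atTop fun N : ℕ => Ioc (-N : ℝ) N :=
    aecover_Ioc (tendsto_neg_atTop_atBot.comp tendsto_natCast_atTop_atTop)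
      tendsto_natCast_atTop_atTop
  have hmeas := measurable_expSum hl.le hm
  refine le_of_tendsto (hcov.lintegral_tendsto_of_countably_generated
    hmeas.ennreal_ofReal.aemeasurable) (Eventually.of_forall fun N => ?_)
  have hN : (0 : ℝ) ≤ N := N.cast_nonneg
  have hint := intervalIntegrable_expSum_sub_mul hl.le hm
      (ρ := fun x => Real.exp (-|x|)) (by fun_prop)
  have hnn : ∀ x, 0 ≤ expSum l ψ x := fun x =>
    add_nonneg (Real.exp_pos _).le (Real.exp_pos _).le
  have h1 : ∫ x in (-N : ℝ)..N, (expSum l ψ x - 0) * Real.exp (-|x|) ≤ 4 := by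
    have h2 : ∫ x in (-N : ℝ)..N, (expSum l ψ x - 2) * Real.exp (-|x|) ≤ 0 := by
      rw [← intervalIntegral.integral_add_adjacent_intervals (hint 2 (-N) 0) (hint 2 0 N)]
      have h3 := integral_pos_side_le hl hl1 hm hlip h0 N
      have h4 := integral_neg_side_le hl hl1 hm hlip h0 N
      have h5 : 0 ≤ Real.exp (-N) * (8 * (2 * Real.cosh (ψ N) - 2)) :=
        mul_nonneg (Real.exp_pos _).le (by linarith [Real.one_le_cosh (ψ N)])
      have h6 : 0 ≤ Real.exp (-N) * (8 * (2 * Real.cosh (-ψ (-N)) - 2)) :=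
        mul_nonneg (Real.exp_pos _).le (by linarith [Real.one_le_cosh (-ψ (-N))])
      linarith
    have h7 : ∫ x in (-N : ℝ)..N, (expSum l ψ x - 0) * Real.exp (-|x|) =
        (∫ x in (-N : ℝ)..N, (expSum l ψ x - 2) * Real.exp (-|x|)) +
          2 * ∫ x in (-N : ℝ)..N, Real.exp (-|x|) := by
      rw [← intervalIntegral.integral_const_mul, ← intervalIntegral.integral_add (hint 2 _ _)
        (Continuous.intervalIntegrable (by fun_prop) _ _)]
      congr 1
      funext x
      ring
    linarith [integral_exp_neg_abs_le N]
  have h8 : ∫⁻ x in Ioc (-N : ℝ) N, ENNReal.ofReal (expSum l ψ x) ∂nuOne =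
      ENNReal.ofReal (1 / 2 * ∫ x in (-N : ℝ)..N, (expSum l ψ x - 0) * Real.exp (-|x|)) := by
    rw [nuOne, restrict_withDensity measurableSet_Ioc, lintegral_withDensity_eq_lintegral_mul _
      (by fun_prop) hmeas.ennreal_ofReal, ← intervalIntegral.integral_const_mul,
      intervalIntegral.integral_of_le (by linarith), ofReal_integral_eq_lintegral_ofReal
      (((hint 0 (-N) N).const_mul _).1) (Eventually.of_forall fun x => ?_)]
    · refine lintegral_congr fun x => ?_
      rw [Pi.mul_apply, ← ENNReal.ofReal_mul (by positivity)]
      congr 1; ring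
    · have := hnn x
      simp only [sub_zero, Pi.zero_apply]
      positivity
  rw [h8, show (2 : ENNReal) = ENNReal.ofReal 2 by simp]
  exact ENNReal.ofReal_le_ofReal (by linarith)

/-- The infimum-convolution inequality (property `(τ)`) for increasing functions with a small
Lipschitz constant, under the two-sided exponential law. -/
lemma lintegral_infConv_mul_le (hl : 0 < l) (hl1 : l ≤ 1 / 1000) (hm : Monotone ψ)
    (hlip : ∀ x y, x ≤ y → ψ y ≤ ψ x + l * (y - x)) :
    (∫⁻ x, ENNReal.ofReal (Real.exp (infConv l ψ x)) ∂nuOne) *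
      ∫⁻ x, ENNReal.ofReal (Real.exp (-ψ x)) ∂nuOne ≤ 1 := by
  -- both factors are multiplied by inverse constants when `ψ` is shifted to vanish at the origin
  set φ : ℝ → ℝ := fun x => ψ x - ψ 0 with hφ
  have hφm : Monotone φ := fun x y h => sub_le_sub_right (hm h) _
  have hφl : ∀ x y, x ≤ y → φ y ≤ φ x + l * (y - x) := fun x y h => by
    have := hlip x y h
    simp only [hφ]; linarith
  have hsum := lintegral_expSum_le hl hl1 hφm hφl (by simp [hφ])
  have hinf : ∀ x, infConv l ψ x = ψ 0 + infConv l φ x := by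
    intro x
    refine le_antisymm ?_ ?_
    · rw [← sub_le_iff_le_add']
      refine le_ciInf fun s => ?_
      have := infConv_le hl.le hm x s.2.1 s.2.2
      simp only [hφ]
      linarith
    · refine le_ciInf fun s => ?_
      have := infConv_le hl.le hφm x s.2.1 s.2.2
      simp only [hφ] at this
      linarith
  have h1 : ∫⁻ x, ENNReal.ofReal (Real.exp (infConv l ψ x)) ∂nuOne =
      ENNReal.ofReal (Real.exp (ψ 0)) *
        ∫⁻ x, ENNReal.ofReal (Real.exp (infConv l φ x)) ∂nuOne := by
    rw [← lintegral_const_mul _ (infConv_mono hl.le hφm).measurable.exp.ennreal_ofReal]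
    refine lintegral_congr fun x => ?_
    rw [hinf, Real.exp_add, ENNReal.ofReal_mul (Real.exp_pos _).le]
  have h2 : ∫⁻ x, ENNReal.ofReal (Real.exp (-ψ x)) ∂nuOne =
      ENNReal.ofReal (Real.exp (-ψ 0)) *
        ∫⁻ x, ENNReal.ofReal (Real.exp (-φ x)) ∂nuOne := by
    rw [← lintegral_const_mul _ (by have := hφm.measurable; fun_prop)]
    refine lintegral_congr fun x => ?_
    rw [← ENNReal.ofReal_mul (Real.exp_pos _).le, ← Real.exp_add]
    congr 2
    simp only [hφ]; ring
  have h3 : ENNReal.ofReal (Real.exp (ψ 0)) * ENNReal.ofReal (Real.exp (-ψ 0)) = 1 := by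
    rw [← ENNReal.ofReal_mul (Real.exp_pos _).le, ← Real.exp_add]; simp
  rw [h1, h2, mul_mul_mul_comm, h3, one_mul]
  have h4 : ∫⁻ x, ENNReal.ofReal (expSum l φ x) ∂nuOne =
      (∫⁻ x, ENNReal.ofReal (Real.exp (infConv l φ x)) ∂nuOne) +
        ∫⁻ x, ENNReal.ofReal (Real.exp (-φ x)) ∂nuOne := by
    rw [← lintegral_add_left (infConv_mono hl.le hφm).measurable.exp.ennreal_ofReal]
    refine lintegral_congr fun x => ?_
    rw [expSum, ENNReal.ofReal_add (Real.exp_pos _).le (Real.exp_pos _).le]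
  rw [h4] at hsum
  generalize (∫⁻ x, ENNReal.ofReal (Real.exp (infConv l φ x)) ∂nuOne) = A at hsum ⊢
  generalize (∫⁻ x, ENNReal.ofReal (Real.exp (-φ x)) ∂nuOne) = B at hsum ⊢
  lift A to NNReal using ne_top_of_le_ne_top ENNReal.ofNat_ne_top (le_self_add.trans hsum)
  lift B to NNReal using ne_top_of_le_ne_top ENNReal.ofNat_ne_top (le_add_self.trans hsum)
  norm_cast at hsum ⊢
  have hsum' : (A : ℝ) + B ≤ 2 := by exact_mod_cast hsum
  have : (A : ℝ) * B ≤ 1 := by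
    nlinarith [sq_nonneg ((A : ℝ) - B), A.coe_nonneg, B.coe_nonneg]
  exact_mod_cast this

end

end Penalty

/-! ### Rearrangement on the line, and the product inequality -/

namespace Penalty

lemma lintegral_le_of_forall_meas_le {α β : Type*} [MeasurableSpace α] [MeasurableSpace β]
    {μ : Measure α} {ν : Measure β} {X : α → ℝ} {Y : β → ℝ} (hX : AEMeasurable X μ)
    (hY : AEMeasurable Y ν) (hX0 : ∀ a, 0 ≤ X a) (hY0 : ∀ b, 0 ≤ Y b)
    (h : ∀ z, 0 < z → μ {a | z ≤ X a} ≤ ν {b | z ≤ Y b}) :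
    ∫⁻ a, ENNReal.ofReal (X a) ∂μ ≤ ∫⁻ b, ENNReal.ofReal (Y b) ∂ν := by
  rw [lintegral_eq_lintegral_meas_le μ (Eventually.of_forall hX0) hX,
    lintegral_eq_lintegral_meas_le ν (Eventually.of_forall hY0) hY]
  exact setLIntegral_mono' measurableSet_Ioi fun z hz => h z hz

/-- A set of reals all of whose points `x` have `nuOne (-∞, x]` at most `c` has measure at most
`c`. -/
lemma nuOne_le_of_forall_Iic_le {L : Set ℝ} {c : ENNReal}
    (h : ∀ x ∈ L, nuOne (Iic x) ≤ c) : nuOne L ≤ c := by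
  rcases eq_or_ne c 0 with rfl | h0
  · have : L = ∅ := eq_empty_of_forall_notMem fun x hx =>
      (nuOne_Iic_pos x).ne' (le_antisymm (h x hx) zero_le)
    simp [this]
  rcases lt_or_ge c 1 with h1 | h1
  · obtain ⟨b, rfl⟩ := exists_nuOne_Iic_eq (pos_iff_ne_zero.2 h0) h1
    exact measure_mono fun x hx => nuOne_Iic_le_iff.1 (h x hx)
  · exact prob_le_one.trans h1

/-- Conversely, the points `x` with `nuOne (-∞, x]` at most `c` fill up measure `c`. -/
lemma le_nuOne_of_forall_Iic_le {L : Set ℝ} {c : ENNReal} (hc : c ≤ 1)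
    (h : ∀ x, nuOne (Iic x) ≤ c → x ∈ L) : c ≤ nuOne L := by
  rcases eq_or_ne c 0 with rfl | h0
  · exact zero_le
  rcases hc.lt_or_eq with h1 | rfl
  · obtain ⟨b, rfl⟩ := exists_nuOne_Iic_eq (pos_iff_ne_zero.2 h0) h1
    exact measure_mono fun x hx => h x (nuOne_Iic_le_iff.2 hx)
  · have : L = univ := eq_univ_of_forall fun x => h x prob_le_one
    rw [this, measure_univ]

section

variable {Ω : Type*} [MeasurableSpace Ω]

/-- The possible values `l * t + ρ` of the regularized rearrangement at `x`. -/
def rearrValues (l : ℝ) (μ : Measure Ω) (g : Ω → ENNReal) (x : ℝ) : Set ℝ :=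
  {c | ∃ t ρ : ℝ, 0 ≤ t ∧ 0 ≤ ρ ∧
    nuOne (Iic (x - t)) ≤ μ {ω | ENNReal.ofReal (Real.exp (-ρ)) ≤ g ω} ∧ c = l * t + ρ}

/-- The increasing rearrangement of `-log g` on the real line with the law `nuOne`, made
`l`-Lipschitz by an infimum-convolution with the linear cost `l * t`. The sublevel sets of the
rearrangement itself are the half-lines that have the measure of those of `-log g`. -/
noncomputable def rearr (l : ℝ) (μ : Measure Ω) (g : Ω → ENNReal) (x : ℝ) : ℝ :=
  sInf (rearrValues l μ g x)

variable {l : ℝ} {μ : Measure Ω} {g : Ω → ENNReal}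

lemma bddBelow_rearrValues (hl : 0 ≤ l) (x : ℝ) : BddBelow (rearrValues l μ g x) := by
  refine ⟨0, ?_⟩
  rintro _ ⟨t, ρ, ht, hρ, -, rfl⟩
  positivity

lemma rearrValues_nonempty (hg : ∫⁻ ω, g ω ∂μ ≠ 0) (x : ℝ) : (rearrValues l μ g x).Nonempty := by
  obtain ⟨n, hn⟩ : ∃ n : ℕ, 0 < μ {ω | ENNReal.ofReal (Real.exp (-n)) ≤ g ω} := by
    by_contra! h
    refine hg ((lintegral_congr_ae ?_).trans lintegral_zero)
    have h2 : μ (⋃ n : ℕ, {ω | ENNReal.ofReal (Real.exp (-n)) ≤ g ω}) = 0 :=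
      measure_iUnion_null fun n => le_antisymm (h n) zero_le
    refine measure_mono_null (fun ω hω => ?_) h2
    have hω0 : 0 < g ω := pos_iff_ne_zero.2 hω
    have hlim : Tendsto (fun n : ℕ => ENNReal.ofReal (Real.exp (-n))) atTop (nhds 0) := by
      rw [← ENNReal.ofReal_zero]
      exact ENNReal.tendsto_ofReal
        (Real.tendsto_exp_neg_atTop_nhds_zero.comp tendsto_natCast_atTop_atTop)
    obtain ⟨n, hn⟩ := (hlim.eventually_lt_const hω0).exists
    exact mem_iUnion.2 ⟨n, hn.le⟩
  obtain ⟨b, hb⟩ : ∃ b, nuOne (Iic b) ≤ μ {ω | ENNReal.ofReal (Real.exp (-n)) ≤ g ω} := by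
    rcases lt_or_ge (μ {ω | ENNReal.ofReal (Real.exp (-n)) ≤ g ω}) 1 with h1 | h1
    · obtain ⟨b, hb⟩ := exists_nuOne_Iic_eq hn h1
      exact ⟨b, hb.le⟩
    · exact ⟨0, prob_le_one.trans h1⟩
  exact ⟨_, max 0 (x - b), n, le_max_left _ _, n.cast_nonneg,
    (measure_mono (Iic_subset_Iic.2 (by linarith [le_max_right 0 (x - b)]))).trans hb, rfl⟩

lemma rearr_mono (hl : 0 ≤ l) (hg : ∫⁻ ω, g ω ∂μ ≠ 0) : Monotone (rearr l μ g) := by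
  intro x y hxy
  refine csInf_le_csInf (bddBelow_rearrValues hl x) (rearrValues_nonempty hg y) ?_
  rintro _ ⟨t, ρ, ht, hρ, h, rfl⟩
  exact ⟨t, ρ, ht, hρ, (measure_mono (Iic_subset_Iic.2 (by linarith))).trans h, rfl⟩

lemma rearr_lip (hl : 0 ≤ l) (hg : ∫⁻ ω, g ω ∂μ ≠ 0) (x y : ℝ) (hxy : x ≤ y) :
    rearr l μ g y ≤ rearr l μ g x + l * (y - x) := by
  rw [← sub_le_iff_le_add]
  refine le_csInf (rearrValues_nonempty hg x) ?_
  rintro _ ⟨t, ρ, ht, hρ, h, rfl⟩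
  have : rearr l μ g y ≤ l * (t + (y - x)) + ρ :=
    csInf_le (bddBelow_rearrValues hl y)
      ⟨t + (y - x), ρ, by linarith, hρ, by rwa [show y - (t + (y - x)) = x - t by ring], rfl⟩
  linarith

lemma lintegral_le_lintegral_rearr [IsProbabilityMeasure μ] (hl : 0 ≤ l) (hgm : Measurable g)
    (hg1 : ∀ ω, g ω ≤ 1) (hg : ∫⁻ ω, g ω ∂μ ≠ 0) :
    ∫⁻ ω, g ω ∂μ ≤ ∫⁻ x, ENNReal.ofReal (Real.exp (-rearr l μ g x)) ∂nuOne := by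
  have htop : ∀ ω, g ω ≠ ⊤ := fun ω => ne_top_of_le_ne_top ENNReal.one_ne_top (hg1 ω)
  have h1 : ∫⁻ ω, g ω ∂μ = ∫⁻ ω, ENNReal.ofReal (g ω).toReal ∂μ :=
    lintegral_congr fun ω => (ENNReal.ofReal_toReal (htop ω)).symm
  rw [h1]
  refine lintegral_le_of_forall_meas_le hgm.ennreal_toReal.aemeasurable
    (rearr_mono hl hg).measurable.neg.exp.aemeasurable (fun _ => ENNReal.toReal_nonneg)
    (fun _ => (Real.exp_pos _).le) fun z hz => ?_
  rcases le_or_gt z 1 with hz1 | hz1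
  · refine le_nuOne_of_forall_Iic_le prob_le_one fun x hx => ?_
    have h2 : rearr l μ g x ≤ l * 0 + -Real.log z := by
      refine csInf_le (bddBelow_rearrValues hl x)
        ⟨0, -Real.log z, le_rfl, by linarith [Real.log_nonpos hz.le hz1], ?_, rfl⟩
      rw [sub_zero, neg_neg, Real.exp_log hz]
      refine hx.trans (measure_mono fun ω hω => ?_)
      exact ENNReal.ofReal_le_of_le_toReal hω
    show z ≤ Real.exp (-rearr l μ g x)
    rw [← Real.log_le_iff_le_exp hz]
    linarith
  · have : {ω | z ≤ (g ω).toReal} = ∅ := eq_empty_of_forall_notMem fun ω hω => by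
      have h3 : (g ω).toReal ≤ 1 :=
        ENNReal.toReal_le_of_le_ofReal zero_le_one (by simpa using hg1 ω)
      exact absurd (hz1.trans_le hω) (not_lt.2 h3)
    rw [this, measure_empty]
    exact zero_le

/-- The two parts of `Concentrates`, for a distance `s + t` that is split into a
quadratic and a linear part. -/
lemma Concentrates.conc_le {h : Ω → Ω → ℝ} (H : Concentrates μ h) {B : Set Ω}
    (hB : MeasurableSet B) (h0 : 0 < μ B) (h1 : μ B < 1) {s t : ℝ} (hs : 0 ≤ s) (ht : 0 ≤ t)
    (hst : 0 < s + t) :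
    conc (μ B) (s + t) ≤ μ {x | toSet h x B ≤ 4 * s ^ 2 + 2 * t} := by
  rcases le_total (s + t) 1 with h | h
  · refine (H.small B hB h0 h1 _ hst h).trans (measure_mono fun x (hx : _ ≤ _) =>
      mem_ofPred.2 (hx.trans ?_))
    nlinarith [sq_nonneg (s - t)]
  · refine (H.large B hB h0 h1 _ h).trans (measure_mono fun x (hx : _ ≤ _) =>
      mem_ofPred.2 (hx.trans ?_))
    rcases le_total s (1 / 4) with h2 | h2 <;> nlinarith

/-- The comparison of the infimum-convolution on `Ω` with that on the line. The set `{I < z}`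
contains enlargements of superlevel sets `B` of `g`, whose measures are, by `H`, at least
those of the enlarged half-lines of measure `μ B`; the latter exhaust `{exp w < z}`, for `w` the
infimum-convolution on the line. -/
lemma lintegral_le_lintegral_infConv_rearr [IsProbabilityMeasure μ] {h : Ω → Ω → ℝ}
    (hp : IsPenalty h) (H : Concentrates μ h) (hgm : Measurable g)
    (hg : ∫⁻ ω, g ω ∂μ ≠ 0) {I : Ω → ENNReal} (hIm : AEMeasurable I μ)
    (hI : ∀ ω ω', I ω ≤ ENNReal.ofReal (Real.exp (8000⁻¹ * h ω ω')) / g ω') :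
    ∫⁻ ω, I ω ∂μ ≤
      ∫⁻ x, ENNReal.ofReal (Real.exp (infConv (1 / 1000) (rearr (1 / 1000) μ g) x)) ∂nuOne := by
  set l : ℝ := 1 / 1000 with hl
  have hl0 : 0 ≤ l := by norm_num [hl]
  obtain ⟨ω₀, hω₀⟩ : ∃ ω, g ω ≠ 0 := by
    by_contra! h
    exact hg (by simp [h])
  have htop : ∀ ω, I ω ≠ ⊤ := fun ω =>
    ne_top_of_le_ne_top (ENNReal.div_ne_top ENNReal.ofReal_ne_top hω₀) (hI ω ω₀)
  have h1 : ∫⁻ ω, I ω ∂μ = ∫⁻ ω, ENNReal.ofReal (I ω).toReal ∂μ :=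
    lintegral_congr fun ω => (ENNReal.ofReal_toReal (htop ω)).symm
  have hwm : Measurable fun x => Real.exp (infConv l (rearr l μ g) x) :=
    (infConv_mono hl0 (rearr_mono hl0 hg)).measurable.exp
  rw [h1]
  refine lintegral_le_of_forall_meas_le hIm.ennreal_toReal hwm.aemeasurable
    (fun _ => ENNReal.toReal_nonneg) (fun _ => (Real.exp_pos _).le) fun z hz => ?_
  have hlt : nuOne {x | Real.exp (infConv l (rearr l μ g) x) < z} ≤ μ {ω | (I ω).toReal < z} := by
    refine nuOne_le_of_forall_Iic_le fun x hx => ?_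
    rw [mem_ofPred, ← Real.lt_log_iff_exp_lt hz] at hx
    obtain ⟨⟨s, hs0, hs1⟩, hs⟩ := exists_lt_of_ciInf_lt hx
    rw [← lt_sub_iff_add_lt] at hs
    obtain ⟨_, ⟨t, ρ, ht, hρ, hx', rfl⟩, hc⟩ :=
      exists_lt_of_csInf_lt (rearrValues_nonempty hg _) hs
    dsimp only at hx' hc
    set B := {ω | ENNReal.ofReal (Real.exp (-ρ)) ≤ g ω} with hBdef
    have hB : MeasurableSet B := measurableSet_le measurable_const hgm
    -- `I` is below `z` at all points close to `B` in the sense of `h`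
    have hclose : ∀ ω, ∀ ω' ∈ B, 8000⁻¹ * h ω ω' + ρ < Real.log z → (I ω).toReal < z := by
      intro ω ω' hω' hlog
      have h2 : I ω ≤ ENNReal.ofReal (Real.exp (8000⁻¹ * h ω ω' + ρ)) := by
        refine (hI ω ω').trans ((ENNReal.div_le_div_left hω' _).trans (le_of_eq ?_))
        rw [← ENNReal.ofReal_div_of_pos (Real.exp_pos _), ← Real.exp_sub, sub_neg_eq_add]
      refine (ENNReal.toReal_le_of_le_ofReal (Real.exp_pos _).le h2).trans_lt ?_
      rwa [← Real.lt_log_iff_exp_lt hz]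
    have hself : B ⊆ {ω | (I ω).toReal < z} := fun ω hω => hclose ω ω hω (by
      rw [hp.diag, mul_zero, zero_add]
      have : 0 ≤ l * t := by positivity
      have : 0 ≤ l / 2 * s ^ 2 := by positivity
      linarith)
    have hB0 : 0 < μ B := (nuOne_Iic_pos _).trans_le hx'
    rcases prob_le_one.lt_or_eq (a := μ B) with hB1 | hB1
    swap
    · exact prob_le_one.trans (hB1.ge.trans (measure_mono hself))
    rcases (add_nonneg hs0 ht).eq_or_lt with hst | hst
    · rw [show x - s - t = x by linarith] at hx'
      exact hx'.trans (measure_mono hself)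
    obtain ⟨b, hb⟩ := exists_nuOne_Iic_eq hB0 hB1
    rw [← hb, nuOne_Iic_le_iff] at hx'
    have h3 : nuOne (Iic x) ≤ conc (μ B) (s + t) := by
      rw [← hb, conc_nuOne_Iic]
      exact nuOne_Iic_le_iff.2 (by linarith)
    refine h3.trans ((H.conc_le hB hB0 hB1 hs0 ht hst).trans (measure_mono fun ω hω => ?_))
    have hBne : Nonempty B := (nonempty_of_measure_ne_zero hB0.ne').to_subtype
    have h4 : toSet h ω B < 8000 * (Real.log z - ρ) := by
      refine lt_of_le_of_lt hω ?_
      -- the constant `8000` makes `(4 s² + 2 t) / 8000` at most `l / 2 * s² + l * t`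
      rw [hl] at hc
      linarith
    obtain ⟨⟨ω', hω'⟩, h5⟩ := exists_lt_of_ciInf_lt h4
    exact hclose ω ω' hω' (by linarith)
  have hcompl1 : {ω | z ≤ (I ω).toReal} = {ω | (I ω).toReal < z}ᶜ := by ext; simp
  have hcompl2 : {x | z ≤ Real.exp (infConv l (rearr l μ g) x)} =
      {x | Real.exp (infConv l (rearr l μ g) x) < z}ᶜ := by ext; simp
  rw [hcompl1, hcompl2, prob_compl_eq_one_sub (measurableSet_lt hwm measurable_const),
    prob_compl_eq_one_sub₀ (nullMeasurableSet_lt hIm.ennreal_toReal aemeasurable_const)]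
  exact tsub_le_tsub_left hlt _

/-- The infimum-convolution inequality on `Ω`, which is what the induction over the number of
factors needs. -/
lemma lintegral_mul_lintegral_le [IsProbabilityMeasure μ] {h : Ω → Ω → ℝ}
    (hp : IsPenalty h) (H : Concentrates μ h) (hgm : Measurable g) (hg1 : ∀ ω, g ω ≤ 1)
    {I : Ω → ENNReal} (hIm : AEMeasurable I μ)
    (hI : ∀ ω ω', I ω ≤ ENNReal.ofReal (Real.exp (8000⁻¹ * h ω ω')) / g ω') :
    ∫⁻ ω, I ω ∂μ ≤ 1 / ∫⁻ ω, g ω ∂μ := by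
  rcases eq_or_ne (∫⁻ ω, g ω ∂μ) 0 with h0 | h0
  · simp [h0]
  have hg' : ∫⁻ ω, g ω ∂μ ≠ ⊤ := by
    refine ne_top_of_le_ne_top ENNReal.one_ne_top ((lintegral_mono hg1).trans ?_)
    simp
  rw [ENNReal.le_div_iff_mul_le (Or.inl h0) (Or.inl hg')]
  exact (mul_le_mul' (lintegral_le_lintegral_infConv_rearr hp H hgm h0 hIm hI)
    (lintegral_le_lintegral_rearr (by norm_num) hgm hg1 h0)).trans
    (lintegral_infConv_mul_le (by norm_num) le_rfl (rearr_mono (by norm_num) h0)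
      (rearr_lip (by norm_num) h0))

lemma bddBelow_range_sum {h : Ω → Ω → ℝ} (hp : IsPenalty h) {N : ℕ} (A : Set (Fin N → Ω))
    (x : Fin N → Ω) :
    BddBelow (range fun y : A => ∑ i, h (x i) ((y : Fin N → Ω) i)) := by
  refine ⟨0, ?_⟩
  rintro _ ⟨y, rfl⟩
  exact Finset.sum_nonneg fun i _ => hp.nonneg _ _

lemma f_cons_le {h : Ω → Ω → ℝ} (hp : IsPenalty h) {N : ℕ} {A : Set (Fin (N + 1) → Ω)}
    {A' : Set (Fin N → Ω)} {ω ω' : Ω} (hA' : ∀ y ∈ A', Fin.cons ω' y ∈ A) (hne : A'.Nonempty)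
    (x : Fin N → Ω) :
    f h A (Fin.cons ω x : Fin (N + 1) → Ω) ≤ h ω ω' + f h A' x := by
  have : Nonempty A' := hne.to_subtype
  rw [← sub_le_iff_le_add']
  refine le_ciInf fun y => ?_
  rw [sub_le_iff_le_add']
  have := ciInf_le (bddBelow_range_sum hp A (Fin.cons ω x)) ⟨Fin.cons ω' y, hA' y y.2⟩
  simpa [Fin.sum_univ_succ, f] using this

lemma lintegral_exp_f_le [IsProbabilityMeasure μ] {h : Ω → Ω → ℝ} (hp : IsPenalty h)
    (hmeas : MeasurabilityConvention μ h) (H : Concentrates μ h) (N : ℕ) :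
    ∀ A : Set (Fin N → Ω), MeasurableSet A →
      ∫⁻ x, ENNReal.ofReal (Real.exp (8000⁻¹ * f h A x)) ∂(Measure.pi fun _ : Fin N => μ) ≤
        1 / (Measure.pi fun _ : Fin N => μ) A := by
  induction N with
  | zero =>
    intro A _
    rcases A.eq_empty_or_nonempty with rfl | ⟨a, ha⟩
    · simp
    · have h1 : A = univ := eq_univ_of_forall fun x => by rwa [Subsingleton.elim x a]
      have : Nonempty A := ⟨a, ha⟩
      simp [h1, f]
  | succ N ih =>
    intro A hA
    set P : Measure (Fin N → Ω) := Measure.pi fun _ : Fin N => μ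
    set e := MeasurableEquiv.piFinSuccAbove (fun _ : Fin (N + 1) => Ω) 0
    have he : ∀ (ω : Ω) (x : Fin N → Ω), e.symm (ω, x) = Fin.cons ω x := fun ω x => by
      simp [e, MeasurableEquiv.piFinSuccAbove_symm_apply, Fin.insertNthEquiv]
    have hmp : MeasurePreserving e.symm (μ.prod P) (Measure.pi fun _ : Fin (N + 1) => μ) :=
      (measurePreserving_piFinSuccAbove (fun _ : Fin (N + 1) => μ) 0).symm
    have hA' : MeasurableSet (e.symm ⁻¹' A) := e.symm.measurable hA
    have hF : AEMeasurable (fun p => ENNReal.ofReal (Real.exp (8000⁻¹ * f h A (e.symm p))))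
        (μ.prod P) :=
      (((hmeas (N + 1) A hA).comp_quasiMeasurePreserving
        hmp.quasiMeasurePreserving).const_mul _).exp.ennreal_ofReal
    rw [← hmp.lintegral_comp_emb e.symm.measurableEmbedding, lintegral_prod _ hF,
      ← hmp.measure_preimage hA.nullMeasurableSet, Measure.prod_apply hA']
    refine lintegral_mul_lintegral_le hp H (measurable_measure_prodMk_left hA')
      (fun _ => prob_le_one) hF.lintegral_prod_right' fun ω ω' => ?_
    rcases eq_or_ne (P (Prod.mk ω' ⁻¹' (e.symm ⁻¹' A))) 0 with h0 | h0
    · rw [h0, ENNReal.div_zero (ENNReal.ofReal_pos.2 (Real.exp_pos _)).ne']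
      exact le_top
    have hsec : MeasurableSet (Prod.mk ω' ⁻¹' (e.symm ⁻¹' A)) := measurable_prodMk_left hA'
    calc ∫⁻ x, ENNReal.ofReal (Real.exp (8000⁻¹ * f h A (e.symm (ω, x)))) ∂P
        ≤ ∫⁻ x, ENNReal.ofReal (Real.exp (8000⁻¹ * h ω ω')) *
            ENNReal.ofReal (Real.exp (8000⁻¹ * f h (Prod.mk ω' ⁻¹' (e.symm ⁻¹' A)) x)) ∂P := by
          refine lintegral_mono fun x => ?_
          rw [← ENNReal.ofReal_mul (Real.exp_pos _).le, ← Real.exp_add, he]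
          refine ENNReal.ofReal_le_ofReal (Real.exp_le_exp.2 ?_)
          have := f_cons_le hp (A := A) (A' := Prod.mk ω' ⁻¹' (e.symm ⁻¹' A)) (ω := ω) (ω' := ω')
            (fun y hy => by rw [← he]; exact hy) (nonempty_of_measure_ne_zero h0) x
          linarith
      _ ≤ ENNReal.ofReal (Real.exp (8000⁻¹ * h ω ω')) / P (Prod.mk ω' ⁻¹' (e.symm ⁻¹' A)) := by
          rw [lintegral_const_mul' _ _ ENNReal.ofReal_ne_top, ENNReal.div_eq_inv_mul, mul_comm]
          refine mul_le_mul' ((ih _ hsec).trans (le_of_eq (one_div _))) le_rfl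

lemma upperIntegral_le_lintegral {G : Ω → ENNReal} (hG : AEMeasurable G μ) :
    upperIntegral μ G ≤ ∫⁻ x, G x ∂μ := by
  -- a measurable majorant that is infinite on a null set containing the exceptional points
  set S := toMeasurable μ {x | G x ≠ hG.mk G x} with hS
  have hS0 : μ S = 0 := by rw [hS, measure_toMeasurable]; exact hG.ae_eq_mk
  have hSm : MeasurableSet S := measurableSet_toMeasurable _ _
  have hsub : {x | G x ≠ hG.mk G x} ⊆ S := subset_toMeasurable _ _
  classical
  refine iInf₂_le_of_le (S.piecewise (fun _ => ⊤) (hG.mk G))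
    (Measurable.piecewise hSm measurable_const hG.measurable_mk)
    (iInf_le_of_le (fun x => ?_) (lintegral_congr_ae ?_).le)
  · by_cases hx : x ∈ S
    · simp [hx]
    · rw [piecewise_eq_of_notMem _ _ _ hx]
      exact (not_not.1 fun h => hx (hsub h)).le
  · have : ∀ᵐ x ∂μ, x ∉ S := measure_eq_zero_iff_ae_notMem.1 hS0
    filter_upwards [this, hG.ae_eq_mk] with x hx hx'
    rw [piecewise_eq_of_notMem _ _ _ hx, hx']

theorem productBound_of_measurabilityConvention [IsProbabilityMeasure μ] {h : Ω → Ω → ℝ}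
    (hp : IsPenalty h) (hmeas : MeasurabilityConvention μ h) (H : Concentrates μ h) :
    ProductBound μ h 8000 := fun N A hA =>
  (upperIntegral_le_lintegral ((hmeas N A hA).const_mul _).exp.ennreal_ofReal).trans
    (lintegral_exp_f_le hp hmeas H N A hA)

end

end Penalty

/-! ### Analytic sets are measurable up to null sets -/

namespace Penalty

lemma isCompact_box (k : ℕ → ℕ) : IsCompact {σ : ℕ → ℕ | ∀ i, σ i ≤ k i} := by
  have := isCompact_univ_pi fun i => (finite_Iic (k i)).isCompact
  convert! this using 1
  ext
  simp [Pi.le_def]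

/-- A neighbourhood of a compact box in Baire space contains a box with finitely many
constraints. -/
lemma exists_box_subset {k : ℕ → ℕ} {W : Set (ℕ → ℕ)} (hW : IsOpen W)
    (hk : {σ : ℕ → ℕ | ∀ i, σ i ≤ k i} ⊆ W) : ∃ n, {σ : ℕ → ℕ | ∀ i < n, σ i ≤ k i} ⊆ W := by
  by_contra! hcon
  simp only [not_subset] at hcon
  choose σ hσ hσW using hcon
  obtain ⟨τ, hτ, φ, hφ, hlim⟩ := (isCompact_box k).tendsto_subseq
    (x := fun n i => min (σ n i) (k i)) fun n i => min_le_right _ _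
  -- `σ n` has the same first `n` coordinates as its truncation
  have hlim' : Tendsto (σ ∘ φ) atTop (nhds τ) := by
    rw [tendsto_pi_nhds] at hlim ⊢
    refine fun i => (hlim i).congr' ?_
    filter_upwards [eventually_gt_atTop i] with n hn
    exact min_eq_left (hσ (φ n) i (hn.trans_le (hφ.id_le n)))
  obtain ⟨n, hn⟩ := (hlim'.eventually_mem (hW.mem_nhds (hk hτ))).exists
  exact hσW _ hn

lemma exists_compact_subset_range {X : Type*} [TopologicalSpace X] [MeasurableSpace X]
    (μ : Measure X) [IsFiniteMeasure μ] [μ.OuterRegular] {F : (ℕ → ℕ) → X} (hF : Continuous F)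
    {ε : ENNReal} (hε : ε ≠ 0) :
    ∃ M ⊆ range F, IsCompact M ∧ μ (range F) ≤ μ M + ε := by
  obtain ⟨δ, hδ0, hδ⟩ := ENNReal.exists_pos_sum_of_countable' hε ℕ
  -- bounding one more coordinate, at the expense of measure `δ n`
  have hstep : ∀ (C : Set (ℕ → ℕ)) (n : ℕ), ∃ m,
      μ (F '' C) ≤ μ (F '' (C ∩ {σ | σ n ≤ m})) + δ n := by
    intro C n
    have hU : F '' C = ⋃ m, F '' (C ∩ {σ | σ n ≤ m}) := by
      rw [← image_iUnion, ← inter_iUnion]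
      congr 1
      refine (inter_eq_left.2 fun σ _ => mem_iUnion.2 ⟨σ n, show σ n ≤ σ n from le_rfl⟩).symm
    have hmono : Monotone fun m => F '' (C ∩ {σ | σ n ≤ m}) := fun a b hab =>
      image_mono (inter_subset_inter_right _ fun σ (hσ : σ n ≤ a) => hσ.trans hab)
    by_cases h0 : μ (F '' C) = 0
    · exact ⟨0, by simp [h0]⟩
    have hlt : μ (F '' C) - δ n < ⨆ m, μ (F '' (C ∩ {σ | σ n ≤ m})) := by
      rw [← hmono.measure_iUnion, ← hU]
      exact ENNReal.sub_lt_self (measure_ne_top _ _) h0 (hδ0 n).ne'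
    obtain ⟨m, hm⟩ := lt_iSup_iff.1 hlt
    exact ⟨m, tsub_le_iff_right.1 hm.le⟩
  choose m hm using hstep
  let C : ℕ → Set (ℕ → ℕ) := fun n => Nat.rec univ (fun n C => C ∩ {σ | σ n ≤ m C n}) n
  have hCsucc : ∀ n, C (n + 1) = C n ∩ {σ | σ n ≤ m (C n) n} := fun n => rfl
  let k : ℕ → ℕ := fun n => m (C n) n
  have hC : ∀ n, C n = {σ | ∀ i < n, σ i ≤ k i} := by
    intro n
    induction n with
    | zero => ext; simp [C]
    | succ n ih =>
      rw [hCsucc, show m (C n) n = k n from rfl, ih]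
      ext σ
      constructor
      · rintro ⟨h1, h2⟩ i hi
        rcases (Nat.lt_succ_iff_lt_or_eq.1 hi) with h | rfl
        exacts [h1 i h, h2]
      · exact fun h => ⟨fun i hi => h i (hi.trans n.lt_succ_self), h n n.lt_succ_self⟩
  have hCm : ∀ n, μ (range F) ≤ μ (F '' C n) + ∑ i ∈ Finset.range n, δ i := by
    intro n
    induction n with
    | zero => simp [C]
    | succ n ih =>
      rw [Finset.sum_range_succ, add_comm _ (δ n), ← add_assoc, hCsucc]
      exact ih.trans (add_le_add_left (hm (C n) n) _)
  refine ⟨F '' {σ | ∀ i, σ i ≤ k i}, image_subset_range _ _, (isCompact_box k).image hF, ?_⟩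
  · rw [Set.measure_eq_iInf_isOpen (F '' {σ | ∀ i, σ i ≤ k i}), ← tsub_le_iff_right]
    refine le_iInf₂ fun U hU => le_iInf fun hUo => ?_
    obtain ⟨n, hn⟩ := exists_box_subset (hUo.preimage hF) (image_subset_iff.1 hU)
    rw [tsub_le_iff_right]
    refine (hCm n).trans (add_le_add (measure_mono ?_) ((ENNReal.sum_le_tsum _).trans hδ.le))
    rw [hC]
    exact image_subset_iff.2 hn

lemma nullMeasurableSet_of_analyticSet {X : Type*} [TopologicalSpace X] [T2Space X]
    [MeasurableSpace X] [BorelSpace X] (μ : Measure X) [IsFiniteMeasure μ] [μ.OuterRegular]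
    {A : Set X} (hA : AnalyticSet A) : NullMeasurableSet A μ := by
  rw [AnalyticSet] at hA
  rcases hA with rfl | ⟨F, hF, rfl⟩
  · exact nullMeasurableSet_empty
  have h1 : ∀ n : ℕ, ∃ M ⊆ range F, IsCompact M ∧ μ (range F) ≤ μ M + (n + 1 : ENNReal)⁻¹ :=
    fun n => exists_compact_subset_range μ hF (by simp)
  choose M hMsub hMc hM using h1
  have hmeas : MeasurableSet (⋃ n, M n) :=
    MeasurableSet.iUnion fun n => (hMc n).isClosed.measurableSet
  have hle : μ (range F) ≤ μ (⋃ n, M n) := by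
    refine ge_of_tendsto (x := atTop) (f := fun n : ℕ => μ (⋃ n, M n) + (n + 1 : ENNReal)⁻¹) ?_
      (Eventually.of_forall fun n => (hM n).trans
        (add_le_add_left (measure_mono (subset_iUnion M n)) _))
    have h2 : Tendsto (fun n : ℕ => ((n + 1 : ℕ) : ENNReal)⁻¹) atTop (nhds 0) :=
      ENNReal.tendsto_inv_nat_nhds_zero.comp (tendsto_add_atTop_nat 1)
    simpa using h2.const_add (μ (⋃ n, M n))
  have := ae_eq_of_subset_of_measure_ge (iUnion_subset hMsub) hle hmeas.nullMeasurableSet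
    (measure_ne_top _ _)
  exact hmeas.nullMeasurableSet.congr this

/-- On a standard Borel space, the sublevel sets of `f_h(A, ·)` are projections of Borel sets. -/
lemma measurabilityConvention_of_standardBorel {Ω : Type*} [MeasurableSpace Ω]
    [StandardBorelSpace Ω] (μ : Measure Ω) [IsProbabilityMeasure μ] {h : Ω → Ω → ℝ}
    (hp : IsPenalty h) : MeasurabilityConvention μ h := by
  intro N A hA
  have hsum : Measurable fun p : (Fin N → Ω) × (Fin N → Ω) => ∑ i, h (p.1 i) (p.2 i) := by
    refine Finset.measurable_sum _ fun i _ => ?_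
    have h1 : Measurable fun p : (Fin N → Ω) × (Fin N → Ω) => (p.1 i, p.2 i) :=
      ((measurable_pi_apply i).comp measurable_fst).prodMk
        ((measurable_pi_apply i).comp measurable_snd)
    exact hp.measurable.comp h1
  let := upgradeStandardBorel Ω
  rcases A.eq_empty_or_nonempty with rfl | hne
  · have : (fun x => f h (∅ : Set (Fin N → Ω)) x) = fun _ => 0 := by
      funext x
      exact Real.iInf_of_isEmpty _
    rw [this]
    exact aemeasurable_const
  have : Nonempty A := hne.to_subtype
  set P : Measure (Fin N → Ω) := Measure.pi fun _ : Fin N => μ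
  have hsub : ∀ c, NullMeasurableSet {x | f h A x < c} P := by
    intro c
    have hset : {x | f h A x < c} = Prod.fst ''
        {p : (Fin N → Ω) × (Fin N → Ω) | p.2 ∈ A ∧ ∑ i, h (p.1 i) (p.2 i) < c} := by
      ext x
      constructor
      · intro hx
        obtain ⟨y, hy⟩ := exists_lt_of_ciInf_lt (show f h A x < c from hx)
        exact ⟨(x, y), ⟨y.2, hy⟩, rfl⟩
      · rintro ⟨⟨x, y⟩, ⟨hy, hlt⟩, rfl⟩
        exact (ciInf_le (bddBelow_range_sum hp A x) ⟨y, hy⟩).trans_lt hlt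
    rw [hset]
    exact nullMeasurableSet_of_analyticSet P (MeasurableSet.analyticSet_image
      ((measurable_snd hA).inter (measurableSet_lt hsum measurable_const)) measurable_fst)
  have hnull : NullMeasurable (fun x => f h A x) P :=
    measurable_of_Iio (δ := NullMeasurableSpace (Fin N → Ω) P) hsub
  exact hnull.aemeasurable

theorem productBound_of_standardBorel {Ω : Type*} [MeasurableSpace Ω]
    [StandardBorelSpace Ω] (μ : Measure Ω) [IsProbabilityMeasure μ] {h : Ω → Ω → ℝ}
    (hp : IsPenalty h) (H : Concentrates μ h) : ProductBound μ h 8000 :=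
  productBound_of_measurabilityConvention hp (measurabilityConvention_of_standardBorel μ hp) H

end Penalty

theorem theorem2p7p1 :
    -- the product inequality, with a universal constant
    (∃ K : ℝ, 0 < K ∧
      -- arbitrary probability spaces, when the functions `f_h(A, ·)` are measurable
      (∀ (Ω : Type u) [MeasurableSpace Ω] (μ : Measure Ω) [IsProbabilityMeasure μ]
        (h : Ω → Ω → ℝ), Penalty.IsPenalty h → Penalty.MeasurabilityConvention μ h →
        Penalty.Concentrates μ h → Penalty.ProductBound μ h K) ∧
      -- standard Borel spaces, without any further measurability assumption
      (∀ (Ω : Type u) [MeasurableSpace Ω] [StandardBorelSpace Ω] (μ : Measure Ω)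
        [IsProbabilityMeasure μ] (h : Ω → Ω → ℝ), Penalty.IsPenalty h →
        Penalty.Concentrates μ h → Penalty.ProductBound μ h K) ∧
      -- the two-sided exponential law
      (IsProbabilityMeasure Penalty.nuOne ∧ Penalty.IsPenalty Penalty.hOne ∧
        Penalty.Concentrates Penalty.nuOne Penalty.hOne ∧
        Penalty.ProductBound Penalty.nuOne Penalty.hOne K) ∧
      -- log-concave measures; the limit at infinity of `ψ'` is that of the right derivative
      (∀ ψ : ℝ → ℝ, ConvexOn ℝ univ ψ → (∀ x, ψ (-x) = ψ x) → (∀ x, 0 ≤ ψ x) →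
        Tendsto (fun x => derivWithin ψ (Ioi x) x) atTop atTop →
        IsProbabilityMeasure (Penalty.nuPsi ψ) ∧
        ∃ C : ℝ, 0 < C ∧ Penalty.IsPenalty (Penalty.hPsi ψ C) ∧
          Penalty.Concentrates (Penalty.nuPsi ψ) (Penalty.hPsi ψ C) ∧
          Penalty.ProductBound (Penalty.nuPsi ψ) (Penalty.hPsi ψ C) K)) ∧
    -- transfer of the concentration conditions to image measures
    (∀ (Ω : Type u) (Ω' : Type v) [MeasurableSpace Ω] [MeasurableSpace Ω'] (μ : Measure Ω)
      [IsProbabilityMeasure μ] (h : Ω → Ω → ℝ) (η : Ω → Ω') (h' : Ω' → Ω' → ℝ),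
      Measurable η → (∀ x y, 0 ≤ h' x y) → (∀ x y, h' (η x) (η y) ≤ h x y) →
      Penalty.Concentrates μ h → Penalty.Concentrates (μ.map η) h') := by
  refine ⟨⟨8000, by norm_num, ?_, ?_, ?_, ?_⟩, ?_⟩
  · intro Ω _ μ _ h hp hmeas H
    exact Penalty.productBound_of_measurabilityConvention hp hmeas H
  · intro Ω _ _ μ _ h hp H
    exact Penalty.productBound_of_standardBorel μ hp H
  · exact ⟨inferInstance, Penalty.isPenalty_hOne, Penalty.concentrates_nuOne_hOne,
      Penalty.productBound_of_standardBorel _ Penalty.isPenalty_hOne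
        Penalty.concentrates_nuOne_hOne⟩
  · intro ψ hc he h0 hd
    obtain ⟨x₁, hx₁, hψ⟩ := Penalty.exists_lt_of_tendsto_derivWithin hc he hd
    have hi := Penalty.integrable_exp_neg_of_convexOn hc he hx₁ hψ
    obtain ⟨T, hT, -, hmap⟩ := Penalty.exists_map_nuOne_eq_nuPsi hc he hi
    have hprob : IsProbabilityMeasure (Penalty.nuPsi ψ) :=
      hmap ▸ Measure.isProbabilityMeasure_map hT.measurable.aemeasurable
    obtain ⟨C, hC, H⟩ := Penalty.exists_concentrates_nuPsi hc he h0 hi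
    have hp := Penalty.isPenalty_hPsi hc h0 hC
    exact ⟨hprob, C, hC, hp, H, Penalty.productBound_of_standardBorel _ hp H⟩
  · intro Ω Ω' _ _ μ _ h η h' hη hnn hle H
    exact H.map hη hnn hle
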